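/- **Setting.** A d-space is a topological space $X$ with a set of paths $[0,1]\to X$ (d-paths) that contains the constant paths and is closed under concatenation and non-decreasing reparametrization; a d-map is a continuous map preserving d-paths. $\vec T(X)_x^y$ denotes the space of d-paths from $x$ to $y$ (compact-open topology) modulo reparametrization by surjective non-decreasing maps of $[0,1]$. The fundamental category $\vec\pi_1(X)$ has the points of $X$ as objects, $\pi_0(\vec T(X)_x^y)$ as morphisms $x\to y$, and composition by concatenation. $E\vec\pi_1(X)$ has as objects the pairs $(x,y)$ with $\vec T(X)_x^y\neq\emptyset$, and as morphisms $(x,y)\to(x',y')$ the pairs $(\sigma *,*\tau)$ with $\sigma\in\vec\pi_1(X)(x',x)$, $\tau\in\vec\pi_1(X)(y,y')$. Let $\mathcal F$ be a family of continuous maps that contains all homotopy equivalences and consists of maps bijective on $\pi_0$ (e.g. weak homotopy equivalences, $\pi_0$-bijections, or isomorphisms on $H_i(-;A)$, $i\le k$, with $A\ne 0$), with an associated notion of a self-map being $\mathcal F$-homotopic to the identity, implied by being homotopic to the identity and implying that the self-map induces the identity on $\pi_0$. An endo-d-map $f$ of $X$ is $\mathcal F$-psp if $\vec T(f):\vec T(X)_x^y\to\vec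 T(X)_{fx}^{fy}$ is in $\mathcal F$ for all objects $(x,y)$. A simple d-homotopy is a d-map $H:X\times\vec I\to X$, where the d-paths of $\vec I=[0,1]$ are the non-decreasing ones. The map $f$ is inessential of flavour $\alpha=+$ (resp. $-$) if there is a simple d-homotopy with all $H_t$ $\mathcal F$-psp from $\mathrm{id}_X$ to $f$ (resp. from $f$ to $\mathrm{id}_X$), and of flavour $\alpha=0$ if there is a d-map $H:X\times I\to X$ with all $H_t$ $\mathcal F$-psp, $H_0=\mathrm{id}_X$, $H_1=f$, where $I=[0,1]$ has only constant d-paths. An $\alpha$-inessential map $f$ with $f(x)=x'$, $f(y)=y'$ is regarded as a morphism $(x,y)\to(x',y')$; for $\alpha=\pm$ these are the $+$-inessential $f$ for which some $-$-inessential $g$ satisfies $g(x')=x$, $g(y')=y$ and $\vec T(g\circ f)$ on $\vec T(X)_x^y$ is $\mathcal F$-homotopic to the identity. Let $\Sigma^\alpha_{\mathcal F}E\vec\pi_1(X)$ be the category with the objects of $E\vec\pi_1(X)$, generated by $E\vec\pi_1(X)$ and the $\alpha$-inessential morphisms (composed as maps), modulo $(f\sigma *,*f\tau)\circ f=f\circ(\sigma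 *,*\tau)$ and $*H(y)\circ f=H(x)*\circ g$ on $(x,y)$ for simple d-homotopies $H$ from $f$ to $g$, where $f$ and $g$ are $\alpha$-inessential at $(x,y)$ and one of them is $\mathrm{id}_X$. The pair component category $\vec\pi_0(X;\alpha,\mathcal F)_*^*$ is its quotient category in which all inessential morphisms become identities; its objects are the components of pairs under zig-zags of inessential morphisms. The directed circle $\vec S^1$ is the unit circle whose d-paths are $t\mapsto e^{ig(t)}$ with $g:[0,1]\to\mathbb R$ continuous and non-decreasing; $\vec T^n=(\vec S^1)^n$, a path being directed iff all its coordinates are. **Proposition.** Let $n\in\mathbb N$, $\alpha\in\{+,-,0,\pm\}$ and $\mathcal F$ as above. 1. There is an isomorphism of categories $\vec\pi_0(\vec T^n;\alpha,\mathcal F)_*^*\cong\prod_{i=1}^n\vec\pi_0(\vec S^1;\alpha,\mathcal F)_*^*$ induced by the coordinate projections, i.e. compatible with the functors $E\vec\pi_1(\vec T^n)\to E\vec\pi_1(\vec S^1)$ induced by the projections. 2. $\vec\pi_0(\vec T^n;\alpha,\mathcal F)_*^*$ has $2^n$ objects. It is isomorphic to the category with objects the bit vectors $\mathbf d\in\{0,1\}^n$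 (with $\Delta\leftrightarrow 0$, $\Gamma\leftrightarrow 1$), morphism sets $\mathrm{Mor}(\mathbf d,\mathbf d')=\prod_{i=1}^n M_i$, where $M_i=\mathbb N=\{1,2,\dots\}$ if $(d_i,d'_i)=(1,0)$ and $M_i=\mathbb N_{\ge 0}$ otherwise, and composition given by coordinatewise addition. Under this isomorphism the component of $(x,y)$ corresponds to the vector with $d_i=0$ if $x_i=y_i$ and $d_i=1$ if $x_i\neq y_i$. 3. Every inessential d-map $F$ of $\vec T^n$ (of any flavour) is a product $F=f_1\times\cdots\times f_n$ of directed homeomorphisms $f_i:\vec S^1\to\vec S^1$ (homeomorphisms that are d-maps together with their inverses). -/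

import Mathlib

open CategoryTheory

universe u v w

/-! ## Directed spaces -/

/-- A d-structure on a topological space `X`: a set of paths `[0,1] → X` (the d-paths) that contains the
constant paths and is closed under concatenation and under non-decreasing (not necessarily
surjective) reparametrization. -/
structure DStructure (X : Type u) [TopologicalSpace X] where
  dpaths : Set C(unitInterval, X)
  const_mem : ∀ x : X, ContinuousMap.const unitInterval x ∈ dpaths
  trans_mem : ∀ {x y z : X} (p : Path x y) (q : Path y z),
    p.toContinuousMap ∈ dpaths → q.toContinuousMap ∈ dpaths → (p.trans q).toContinuousMap ∈ dpaths
  reparam_mem : ∀ γ ∈ dpaths, ∀ φ : C(unitInterval, unitInterval), Monotone φ → γ.comp φ ∈ dpaths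

/-- A d-map is a continuous map that sends d-paths to d-paths. -/
def IsDMap {X : Type u} {Y : Type v} [TopologicalSpace X] [TopologicalSpace Y]
    (D : DStructure X) (E : DStructure Y) (f : C(X, Y)) : Prop :=
  ∀ γ ∈ D.dpaths, f.comp γ ∈ E.dpaths

lemma IsDMap.comp {X : Type u} {Y : Type v} {Z : Type w} [TopologicalSpace X] [TopologicalSpace Y]
    [TopologicalSpace Z] {D : DStructure X} {E : DStructure Y} {F : DStructure Z}
    {g : C(Y, Z)} {f : C(X, Y)} (hg : IsDMap E F g) (hf : IsDMap D E f) : IsDMap D F (g.comp f) :=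
  fun γ hγ => hg _ (hf γ hγ)

lemma monotone_path_trans {X : Type u} [TopologicalSpace X] [Preorder X] {x y z : X}
    (p : Path x y) (q : Path y z) (hp : Monotone p) (hq : Monotone q) : Monotone (p.trans q) := by
  intro s t hst
  have hst' : (s : ℝ) ≤ t := hst
  rw [Path.trans_apply, Path.trans_apply]
  split_ifs with h1 h2 h2
  · exact hp (Subtype.mk_le_mk.2 (by linarith))
  · refine le_trans (hp (unitInterval.le_one' (t := _))) ?_
    exact le_trans (le_of_eq (p.target.trans q.source.symm)) (hq unitInterval.nonneg')
  · exact absurd (hst'.trans h2) h1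
  · exact hq (Subtype.mk_le_mk.2 (by linarith))

/-- The d-structure of non-decreasing paths; on `[0,1]` it gives the directed interval. -/
def monotoneDStructure (X : Type u) [TopologicalSpace X] [Preorder X] : DStructure X where
  dpaths := {γ | Monotone γ}
  const_mem x := fun _ _ _ => le_refl x
  trans_mem p q hp hq := monotone_path_trans p q hp hq
  reparam_mem γ hγ φ hφ := Monotone.comp (g := γ) (f := φ) hγ hφ

/-- The discrete d-structure, with only the constant paths; on `[0,1]` it gives the undirected
interval. -/
def constDStructure (X : Type u) [TopologicalSpace X] : DStructure X where
  dpaths := {γ | ∀ s t, γ s = γ t}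
  const_mem x := fun _ _ => rfl
  trans_mem {x y z} p q hp hq := by
    have hxy : x = y := by simpa using hp 0 1
    have h1 : ∀ t, p t = y := fun t => by simpa using hp t 1
    have h2 : ∀ t, q t = y := fun t => by simpa using hq t 0
    have h : ∀ t, (p.trans q) t = y := fun t => by
      rw [Path.trans_apply]; split_ifs
      · exact h1 _
      · exact h2 _
    intro s t
    exact (h s).trans (h t).symm
  reparam_mem γ hγ φ _ := fun s t => hγ (φ s) (φ t)

/-- The product d-structure: a path is a d-path iff both components are. -/
def DStructure.prod {X : Type u} {Y : Type v} [TopologicalSpace X] [TopologicalSpace Y]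
    (D : DStructure X) (E : DStructure Y) : DStructure (X × Y) where
  dpaths := {γ | ContinuousMap.fst.comp γ ∈ D.dpaths ∧ ContinuousMap.snd.comp γ ∈ E.dpaths}
  const_mem x := ⟨D.const_mem x.1, E.const_mem x.2⟩
  trans_mem p q hp hq := by
    constructor
    · have := D.trans_mem (p.map continuous_fst) (q.map continuous_fst) hp.1 hq.1
      rw [← Path.map_trans] at this
      exact this
    · have := E.trans_mem (p.map continuous_snd) (q.map continuous_snd) hp.2 hq.2
      rw [← Path.map_trans] at this
      exact this
  reparam_mem γ hγ φ hφ := ⟨D.reparam_mem _ hγ.1 φ hφ, E.reparam_mem _ hγ.2 φ hφ⟩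

/-- The product d-structure on a product of a family. -/
def DStructure.pi {ι : Type v} {X : ι → Type u} [∀ i, TopologicalSpace (X i)]
    (D : ∀ i, DStructure (X i)) : DStructure (∀ i, X i) where
  dpaths := {γ | ∀ i, (ContinuousMap.eval i).comp γ ∈ (D i).dpaths}
  const_mem x := fun i => (D i).const_mem (x i)
  trans_mem p q hp hq := fun i => by
    have := (D i).trans_mem (p.map (continuous_apply i)) (q.map (continuous_apply i)) (hp i) (hq i)
    rw [← Path.map_trans] at this
    exact this
  reparam_mem γ hγ φ hφ := fun i => (D i).reparam_mem _ (hγ i) φ hφ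

/-! ## Trace spaces -/

section Traces

variable {X : Type u} [TopologicalSpace X] (D : DStructure X)

/-- The space of d-paths from `x` to `y`, with the compact-open topology. -/
def DPath (x y : X) : Type u := {p : Path x y // p.toContinuousMap ∈ D.dpaths}

instance (x y : X) : TopologicalSpace (DPath D x y) :=
  inferInstanceAs (TopologicalSpace {p : Path x y // p.toContinuousMap ∈ D.dpaths})

variable {D}

/-- The constant d-path. -/
def DPath.refl (x : X) : DPath D x x := ⟨Path.refl x, D.const_mem x⟩

/-- Concatenation of d-paths. -/
noncomputable def DPath.trans {x y z : X} (p : DPath D x y) (q : DPath D y z) : DPath D x z :=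
  ⟨p.1.trans q.1, D.trans_mem p.1 q.1 p.2 q.2⟩

/-- The image of a d-path under a d-map. -/
def DPath.map {Y : Type v} [TopologicalSpace Y] {E : DStructure Y} (f : C(X, Y)) (hf : IsDMap D E f)
    {x y : X} {x' y' : Y} (hx : f x = x') (hy : f y = y') (p : DPath D x y) : DPath E x' y' :=
  ⟨{ toContinuousMap := f.comp p.1.toContinuousMap
     source' := by simp [hx]
     target' := by simp [hy] }, hf _ p.2⟩

/-- `q` is a reparametrization `p ∘ φ` of `p` by a surjective non-decreasing map `φ : unitInterval → I`. -/
def DPath.IsReparam {x y : X} (p q : DPath D x y) : Prop :=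
  ∃ φ : C(unitInterval, unitInterval), Monotone φ ∧ Function.Surjective φ ∧ ∀ t, q.1 t = p.1 (φ t)

variable (D)

/-- The space of traces from `x` to `y`: the quotient of the space of d-paths by the equivalence
relation generated by reparametrization, with the quotient topology. -/
def Trace (x y : X) : Type u := Quot (DPath.IsReparam (D := D) (x := x) (y := y))

instance (x y : X) : TopologicalSpace (Trace D x y) :=
  inferInstanceAs (TopologicalSpace (Quot (DPath.IsReparam (D := D) (x := x) (y := y))))

variable {D}

/-- The trace of a d-path. -/
def Trace.mk {x y : X} (p : DPath D x y) : Trace D x y := Quot.mk _ p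

lemma DPath.continuous_map {Y : Type v} [TopologicalSpace Y] {E : DStructure Y} (f : C(X, Y))
    (hf : IsDMap D E f) {x y : X} {x' y' : Y} (hx : f x = x') (hy : f y = y') :
    Continuous (DPath.map (x := x) (y := y) f hf hx hy) := by
  refine Continuous.subtype_mk ?_ _
  refine continuous_induced_rng.2 ?_
  exact f.continuous_postcomp.comp (continuous_induced_dom.comp continuous_subtype_val)

/-- The continuous map of trace spaces `[σ] ↦ [f ∘ σ]` induced by a d-map. -/
def traceMap {Y : Type v} [TopologicalSpace Y] {E : DStructure Y} (f : C(X, Y))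
    (hf : IsDMap D E f) {x y : X} {x' y' : Y} (hx : f x = x') (hy : f y = y') :
    C(Trace D x y, Trace E x' y') where
  toFun := Quot.lift (fun p => Trace.mk (DPath.map f hf hx hy p)) (by
    rintro p q ⟨φ, hφ, hs, h⟩
    refine Quot.sound ⟨φ, hφ, hs, fun t => ?_⟩
    exact congrArg f (h t))
  continuous_toFun :=
    continuous_quot_lift _ (continuous_quot_mk.comp (DPath.continuous_map f hf hx hy))

lemma reparam_surjective (φ : C(unitInterval, unitInterval)) (h0 : φ 0 = 0) (h1 : φ 1 = 1) : Function.Surjective φ := by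
  intro y
  exact mem_range_of_exists_le_of_exists_ge φ.continuous ⟨0, by rw [h0]; exact unitInterval.nonneg'⟩
    ⟨1, by rw [h1]; exact unitInterval.le_one'⟩

lemma reparam_ends {φ : C(unitInterval, unitInterval)} (hm : Monotone φ) (hs : Function.Surjective φ) :
    φ 0 = 0 ∧ φ 1 = 1 := by
  obtain ⟨a, ha⟩ := hs 0
  obtain ⟨b, hb⟩ := hs 1
  exact ⟨le_antisymm ((hm unitInterval.nonneg').trans ha.le) unitInterval.nonneg',
    le_antisymm unitInterval.le_one' (hb.symm.le.trans (hm unitInterval.le_one'))⟩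

lemma DPath.IsReparam.trans {x y z : X} {p p' : DPath D x y} {q q' : DPath D y z}
    (hp : p.IsReparam p') (hq : q.IsReparam q') : (p.trans q).IsReparam (p'.trans q') := by
  obtain ⟨φ, hφ, hφs, h⟩ := hp
  obtain ⟨χ, hχ, hχs, k⟩ := hq
  obtain ⟨φ0, φ1⟩ := reparam_ends hφ hφs
  obtain ⟨χ0, χ1⟩ := reparam_ends hχ hχs
  let m : unitInterval := ⟨1 / 2, by norm_num, by norm_num⟩
  let a : Path (0 : unitInterval) m :=
    { toFun := fun t => ⟨(φ t : ℝ) / 2, by have := (φ t).2.1; positivity,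
        by have := (φ t).2.2; linarith⟩
      continuous_toFun := by fun_prop
      source' := by simp [φ0]
      target' := by simp [φ1, m] }
  let b : Path m (1 : unitInterval) :=
    { toFun := fun t => ⟨(1 + (χ t : ℝ)) / 2, by have := (χ t).2.1; positivity,
        by have := (χ t).2.2; linarith⟩
      continuous_toFun := by fun_prop
      source' := by simp [χ0, m]
      target' := by ext; simp [χ1] }
  have ha : Monotone a := fun s t hst => Subtype.mk_le_mk.2 (by
    have : (φ s : ℝ) ≤ φ t := hφ hst
    linarith)
  have hb : Monotone b := fun s t hst => Subtype.mk_le_mk.2 (by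
    have : (χ s : ℝ) ≤ χ t := hχ hst
    linarith)
  refine ⟨(a.trans b).toContinuousMap, monotone_path_trans a b ha hb,
    reparam_surjective _ (a.trans b).source (a.trans b).target, fun t => ?_⟩
  change (p'.1.trans q'.1) t = (p.1.trans q.1) ((a.trans b) t)
  rw [Path.trans_apply, Path.trans_apply a b]
  split_ifs with ht
  · rw [h, Path.trans_apply, dif_pos]
    · congr 1
      ext
      change _ = 2 * ((φ _ : ℝ) / 2)
      ring
    · change (φ _ : ℝ) / 2 ≤ 1 / 2
      have := (φ ⟨2 * t, (unitInterval.mul_pos_mem_iff zero_lt_two).2 ⟨t.2.1, ht⟩⟩).2.2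
      linarith
  · rw [k]
    set s : unitInterval := ⟨2 * (t : ℝ) - 1, unitInterval.two_mul_sub_one_mem_iff.2 ⟨(not_le.1 ht).le, t.2.2⟩⟩ with hs
    rw [Path.trans_apply]
    have hbs : ((b s : unitInterval) : ℝ) = (1 + (χ s : ℝ)) / 2 := rfl
    split_ifs with hc
    · have hz : (χ s : ℝ) = 0 := by
        have := (χ s).2.1
        rw [hbs] at hc
        linarith
      have hz' : χ s = 0 := Subtype.ext hz
      have e : (⟨2 * ((b s : unitInterval) : ℝ), (unitInterval.mul_pos_mem_iff zero_lt_two).2 ⟨(b s).2.1, hc⟩⟩ : unitInterval) = 1 := by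
        ext
        change 2 * ((b s : unitInterval) : ℝ) = 1
        rw [hbs, hz]
        norm_num
      rw [e, hz', p.1.target, q.1.source]
    · congr 1
      ext
      change (χ s : ℝ) = 2 * ((b s : unitInterval) : ℝ) - 1
      rw [hbs]
      ring

lemma DPath.isReparam_refl {x y : X} (p : DPath D x y) : p.IsReparam p :=
  ⟨ContinuousMap.id unitInterval, fun _ _ h => h, fun t => ⟨t, rfl⟩, fun _ => rfl⟩

/-- The constant trace. -/
def Trace.refl (x : X) : Trace D x x := Trace.mk (DPath.refl x)

/-- Concatenation of traces. -/
noncomputable def Trace.trans {x y z : X} (σ : Trace D x y) (τ : Trace D y z) : Trace D x z :=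
  Quot.map₂ DPath.trans (fun p _ _ h => (p.isReparam_refl).trans h)
    (fun _ _ q h => h.trans q.isReparam_refl) σ τ

lemma Trace.refl_trans {x y : X} (σ : Trace D x y) : (Trace.refl x).trans σ = σ := by
  induction σ using Quot.ind with | mk p =>
  refine (Quot.sound ⟨⟨fun t => ⟨max 0 (2 * (t : ℝ) - 1), le_max_left _ _,
    max_le zero_le_one (by linarith [t.2.2])⟩, by fun_prop⟩, ?_, ?_, ?_⟩).symm
  · intro s t hst
    have : (s : ℝ) ≤ t := hst
    exact Subtype.mk_le_mk.2 (max_le_max le_rfl (by linarith))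
  · apply reparam_surjective
    · ext; simp
    · ext; simp; norm_num
  · intro t
    change ((Path.refl x).trans p.1) t = _
    rw [Path.trans_apply]
    split_ifs with h
    · have : (⟨max 0 (2 * (t : ℝ) - 1), le_max_left _ _,
          max_le zero_le_one (by linarith [t.2.2])⟩ : unitInterval) = 0 := by
        ext
        exact max_eq_left (by linarith)
      simp [this]
    · congr 1
      ext
      exact (max_eq_right (by linarith)).symm

lemma Trace.trans_refl {x y : X} (σ : Trace D x y) : σ.trans (Trace.refl y) = σ := by
  induction σ using Quot.ind with | mk p =>
  refine (Quot.sound ⟨⟨fun t => ⟨_, Path.Homotopy.transReflReparamAux_mem_I t⟩, by fun_prop⟩,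
    ?_, ?_, ?_⟩).symm
  · intro s t hst
    have : (s : ℝ) ≤ t := hst
    refine Subtype.mk_le_mk.2 ?_
    unfold Path.Homotopy.transReflReparamAux
    split_ifs <;> linarith
  · apply reparam_surjective
    · exact Subtype.ext Path.Homotopy.transReflReparamAux_zero
    · exact Subtype.ext Path.Homotopy.transReflReparamAux_one
  · intro t
    exact congrArg (fun r : Path x y => r t) (Path.Homotopy.trans_refl_reparam p.1)

lemma Trace.trans_assoc {x y z w : X} (ρ : Trace D x y) (σ : Trace D y z) (τ : Trace D z w) :
    (ρ.trans σ).trans τ = ρ.trans (σ.trans τ) := by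
  induction ρ using Quot.ind with | mk p =>
  induction σ using Quot.ind with | mk q =>
  induction τ using Quot.ind with | mk r =>
  refine (Quot.sound ⟨⟨fun t => ⟨_, Path.Homotopy.transAssocReparamAux_mem_I t⟩, by fun_prop⟩,
    ?_, ?_, ?_⟩).symm
  · intro s t hst
    have : (s : ℝ) ≤ t := hst
    refine Subtype.mk_le_mk.2 ?_
    unfold Path.Homotopy.transAssocReparamAux
    split_ifs <;> linarith
  · apply reparam_surjective
    · exact Subtype.ext Path.Homotopy.transAssocReparamAux_zero
    · exact Subtype.ext Path.Homotopy.transAssocReparamAux_one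
  · intro t
    exact congrArg (fun r : Path x w => r t) (Path.Homotopy.trans_assoc_reparam p.1 q.1 r.1)

lemma Trace.continuous_trans_left {x y z : X} (τ : Trace D y z) :
    Continuous (fun σ : Trace D x y => σ.trans τ) := by
  induction τ using Quot.ind with | mk q =>
  refine continuous_coinduced_dom.2 (continuous_quot_mk.comp (Continuous.subtype_mk ?_ _))
  exact Path.continuous_trans.comp (continuous_subtype_val.prodMk continuous_const)

lemma Trace.continuous_trans_right {x y z : X} (σ : Trace D x y) :
    Continuous (fun τ : Trace D y z => σ.trans τ) := by
  induction σ using Quot.ind with | mk p =>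
  refine continuous_coinduced_dom.2 (continuous_quot_mk.comp (Continuous.subtype_mk ?_ _))
  exact Path.continuous_trans.comp (continuous_const.prodMk continuous_subtype_val)

/-! ## The fundamental category -/

variable (D)

/-- The set of morphisms from `x` to `y` in the fundamental category: the path components of the
space of traces from `x` to `y`. -/
def FundHom (x y : X) : Type u := ZerothHomotopy (Trace D x y)

variable {D}

/-- The class of a d-path. -/
def FundHom.mk {x y : X} (p : DPath D x y) : FundHom D x y := ZerothHomotopy.mk (Trace.mk p)

/-- The map on path components induced by a continuous map. -/
def zerothMap {A : Type u} {B : Type v} [TopologicalSpace A] [TopologicalSpace B] (f : C(A, B)) :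
    ZerothHomotopy A → ZerothHomotopy B :=
  ZerothHomotopy.lift (fun a => ZerothHomotopy.mk (f a))
    (fun _ _ γ => ZerothHomotopy.sound (γ.map f.continuous))

/-- The identity at `x`. -/
def FundHom.refl (x : X) : FundHom D x x := FundHom.mk (DPath.refl x)

/-- Composition in the fundamental category, induced by concatenation. -/
noncomputable def FundHom.trans {x y z : X} (σ : FundHom D x y) (τ : FundHom D y z) : FundHom D x z :=
  ZerothHomotopy.lift
    (fun a => ZerothHomotopy.lift (fun b => ZerothHomotopy.mk (a.trans b))
      (fun _ _ γ => ZerothHomotopy.sound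
        (γ.map (f := fun b => a.trans b) (Trace.continuous_trans_right a))) τ)
    (fun a a' γ => by
      obtain ⟨b, rfl⟩ := ZerothHomotopy.mk_surjective τ
      exact ZerothHomotopy.sound
        (γ.map (f := fun a => a.trans b) (Trace.continuous_trans_left b))) σ

/-- The map induced by a d-map on morphisms of the fundamental category. -/
def FundHom.map {Y : Type v} [TopologicalSpace Y] {E : DStructure Y} (f : C(X, Y))
    (hf : IsDMap D E f) {x y : X} {x' y' : Y} (hx : f x = x') (hy : f y = y') :
    FundHom D x y → FundHom E x' y' :=
  zerothMap (traceMap f hf hx hy)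

lemma FundHom.refl_trans {x y : X} (σ : FundHom D x y) : (FundHom.refl x).trans σ = σ := by
  obtain ⟨a, rfl⟩ := ZerothHomotopy.mk_surjective σ
  exact congrArg ZerothHomotopy.mk a.refl_trans

lemma FundHom.trans_refl {x y : X} (σ : FundHom D x y) : σ.trans (FundHom.refl y) = σ := by
  obtain ⟨a, rfl⟩ := ZerothHomotopy.mk_surjective σ
  exact congrArg ZerothHomotopy.mk a.trans_refl

lemma FundHom.trans_assoc {x y z w : X} (ρ : FundHom D x y) (σ : FundHom D y z)
    (τ : FundHom D z w) : (ρ.trans σ).trans τ = ρ.trans (σ.trans τ) := by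
  obtain ⟨a, rfl⟩ := ZerothHomotopy.mk_surjective ρ
  obtain ⟨b, rfl⟩ := ZerothHomotopy.mk_surjective σ
  obtain ⟨c, rfl⟩ := ZerothHomotopy.mk_surjective τ
  exact congrArg ZerothHomotopy.mk (a.trans_assoc b c)

lemma FundHom.map_refl {Y : Type v} [TopologicalSpace Y] {E : DStructure Y} (f : C(X, Y))
    (hf : IsDMap D E f) {x : X} {x' : Y} (hx : f x = x') :
    FundHom.map f hf hx hx (FundHom.refl x) = FundHom.refl x' := by
  subst hx
  rfl

lemma FundHom.map_trans {Y : Type v} [TopologicalSpace Y] {E : DStructure Y} (f : C(X, Y))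
    (hf : IsDMap D E f) {x y z : X} {x' y' z' : Y} (hx : f x = x') (hy : f y = y') (hz : f z = z')
    (σ : FundHom D x y) (τ : FundHom D y z) :
    FundHom.map f hf hx hz (σ.trans τ) =
      (FundHom.map f hf hx hy σ).trans (FundHom.map f hf hy hz τ) := by
  subst hx hy hz
  obtain ⟨a, rfl⟩ := ZerothHomotopy.mk_surjective σ
  obtain ⟨b, rfl⟩ := ZerothHomotopy.mk_surjective τ
  induction a using Quot.ind with | mk p =>
  induction b using Quot.ind with | mk q =>
  refine congrArg (FundHom.mk (D := E)) (Subtype.ext ?_)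
  exact Path.map_trans p.1 q.1 f.continuous

end Traces

/-! ## The extension category of the fundamental category -/

/-- The reachable pairs of a d-space. -/
@[ext]
structure RPair {X : Type u} [TopologicalSpace X] (D : DStructure X) where
  src : X
  tgt : X
  reachable : Nonempty (DPath D src tgt)

section Ext

variable {X : Type u} [TopologicalSpace X] {D : DStructure X}

/-- The extension category: a morphism `(x, y) ⟶ (x', y')` is a pair of a class of d-paths from `x'`
to `x` and a class of d-paths from `y` to `y'`. -/
noncomputable instance extensionCategory : Category (RPair D) where
  Hom p q := FundHom D q.src p.src × FundHom D p.tgt q.tgt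
  id p := (FundHom.refl p.src, FundHom.refl p.tgt)
  comp e e' := (e'.1.trans e.1, e.2.trans e'.2)
  id_comp _ := Prod.ext (FundHom.trans_refl _) (FundHom.refl_trans _)
  comp_id _ := Prod.ext (FundHom.refl_trans _) (FundHom.trans_refl _)
  assoc _ _ _ := Prod.ext (FundHom.trans_assoc _ _ _).symm (FundHom.trans_assoc _ _ _)

/-- The image of a reachable pair under a d-map. -/
def RPair.map {Y : Type v} [TopologicalSpace Y] {E : DStructure Y} (f : C(X, Y))
    (hf : IsDMap D E f) (p : RPair D) : RPair E :=
  ⟨f p.src, f p.tgt, p.reachable.map (DPath.map f hf rfl rfl)⟩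

/-- The functor between extension categories induced by a d-map. -/
noncomputable def extMap {Y : Type v} [TopologicalSpace Y] {E : DStructure Y} (f : C(X, Y))
    (hf : IsDMap D E f) : RPair D ⥤ RPair E where
  obj p := p.map f hf
  map e := (FundHom.map f hf rfl rfl e.1, FundHom.map f hf rfl rfl e.2)
  map_id _ := Prod.ext (FundHom.map_refl f hf rfl) (FundHom.map_refl f hf rfl)
  map_comp _ _ := Prod.ext (FundHom.map_trans f hf rfl rfl rfl _ _)
    (FundHom.map_trans f hf rfl rfl rfl _ _)

end Ext

/-! ## Families of equivalences, homotopy flows, inessential d-maps -/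

/-- A family `𝓕` of continuous maps used to compare trace spaces, sandwiched between the homotopy
equivalences and the maps that are bijective on path components, with the notion of being
`𝓕`-homotopic to the identity, sandwiched between being homotopic to the identity and inducing the
identity on path components.
Instances: (weak) homotopy equivalences, with self-maps inducing the identity on homotopy groups;
`π₀`-bijections, with self-maps inducing the identity on `π₀`; maps inducing isomorphisms on
homology with non-zero coefficients up to degree `k`, with self-maps inducing the identity there. -/
structure EquivalenceFamily where
  IsEquiv : ∀ {A B : Type u} [TopologicalSpace A] [TopologicalSpace B], C(A, B) → Prop
  IsHomotopicToId : ∀ {A : Type u} [TopologicalSpace A], C(A, A) → Prop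
  isEquiv_of_homotopyEquiv : ∀ {A B : Type u} [TopologicalSpace A] [TopologicalSpace B]
    (f : C(A, B)) (g : C(B, A)), (g.comp f).Homotopic (ContinuousMap.id A) →
    (f.comp g).Homotopic (ContinuousMap.id B) → IsEquiv f
  bijective_of_isEquiv : ∀ {A B : Type u} [TopologicalSpace A] [TopologicalSpace B]
    (f : C(A, B)), IsEquiv f → Function.Bijective (zerothMap f)
  isHomotopicToId_of_homotopic : ∀ {A : Type u} [TopologicalSpace A] (f : C(A, A)),
    f.Homotopic (ContinuousMap.id A) → IsHomotopicToId f
  zerothMap_of_isHomotopicToId : ∀ {A : Type u} [TopologicalSpace A] (f : C(A, A)),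
    IsHomotopicToId f → zerothMap f = id

section Flows

variable {X : Type u} [TopologicalSpace X] (𝓕 : EquivalenceFamily.{u}) (D : DStructure X)

/-- `f` is an endo-d-map that is `𝓕`-path space preserving. -/
def IsPsp (f : C(X, X)) : Prop :=
  ∃ hf : IsDMap D D f, ∀ p : RPair D,
    𝓕.IsEquiv (traceMap f hf (rfl : f p.src = f p.src) (rfl : f p.tgt = f p.tgt))

/-- The level map `H_t` of a homotopy. -/
def level (H : C(X × unitInterval, X)) (t : unitInterval) : C(X, X) :=
  H.comp ((ContinuousMap.id X).prodMk (ContinuousMap.const X t))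

/-- A simple (future) d-homotopy: a d-map on the product of `X` with the directed interval. -/
def IsSimpleDHomotopy (H : C(X × unitInterval, X)) : Prop := IsDMap (D.prod (monotoneDStructure unitInterval)) D H

/-- A dihomotopy: a d-map on the product of `X` with the undirected interval. -/
def IsDihomotopy (H : C(X × unitInterval, X)) : Prop := IsDMap (D.prod (constDStructure unitInterval)) D H

/-- There is a future psp homotopy flow from the identity to `f`. -/
def IsFutureInessential (f : C(X, X)) : Prop :=
  ∃ H : C(X × unitInterval, X), IsSimpleDHomotopy D H ∧ (∀ t, IsPsp 𝓕 D (level H t)) ∧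
    level H 0 = ContinuousMap.id X ∧ level H 1 = f

/-- There is a past psp homotopy flow from `f` to the identity. -/
def IsPastInessential (f : C(X, X)) : Prop :=
  ∃ H : C(X × unitInterval, X), IsSimpleDHomotopy D H ∧ (∀ t, IsPsp 𝓕 D (level H t)) ∧
    level H 0 = f ∧ level H 1 = ContinuousMap.id X

/-- There is a neutral psp homotopy flow from the identity to `f`. -/
def IsNeutralInessential (f : C(X, X)) : Prop :=
  ∃ H : C(X × unitInterval, X), IsDihomotopy D H ∧ (∀ t, IsPsp 𝓕 D (level H t)) ∧
    level H 0 = ContinuousMap.id X ∧ level H 1 = f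

/-- The flavours `+`, `-`, `0`, `±`. -/
inductive Flavour
  | future
  | past
  | neutral
  | total

/-- `f` is a morphism from `p` to `q` in the subcategory of inessential maps of flavour `α`. -/
def IsInessential (α : Flavour) (f : C(X, X)) (p q : RPair D) : Prop :=
  f p.src = q.src ∧ f p.tgt = q.tgt ∧
    match α with
    | .future => IsFutureInessential 𝓕 D f
    | .past => IsPastInessential 𝓕 D f
    | .neutral => IsNeutralInessential 𝓕 D f
    | .total => IsFutureInessential 𝓕 D f ∧
        ∃ g : C(X, X), IsPastInessential 𝓕 D g ∧
          ∃ (hgf : IsDMap D D (g.comp f)) (hs : g.comp f p.src = p.src)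
            (ht : g.comp f p.tgt = p.tgt), 𝓕.IsHomotopicToId (traceMap (g.comp f) hgf hs ht)

variable {D}

/-- The d-path `t ↦ H (x, t)` of a simple d-homotopy `H`. -/
def flowPath (H : C(X × unitInterval, X)) (hH : IsSimpleDHomotopy D H) {x a b : X} (ha : H (x, 0) = a)
    (hb : H (x, 1) = b) : DPath D a b :=
  ⟨{ toContinuousMap := H.comp ((ContinuousMap.const unitInterval x).prodMk (ContinuousMap.id unitInterval))
     source' := ha
     target' := hb },
    hH _ ⟨D.const_mem x, fun _ _ h => h⟩⟩

end Flows

/-! ## The category of inessential maps and extensions -/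

section Mixed

variable {X : Type u} [TopologicalSpace X] (𝓕 : EquivalenceFamily.{u}) (α : Flavour)
  (D : DStructure X)

/-- Reachable pairs, as vertices of the quiver of generators. -/
structure MixedVertex (_𝓕 : EquivalenceFamily.{u}) (_α : Flavour) (D : DStructure X) where
  pair : RPair D

variable {D}

/-- The generating morphisms: extensions and inessential d-maps. -/
inductive MixedGen (p q : RPair D) : Type u
  | ext (e : p ⟶ q)
  | map (f : C(X, X)) (hf : IsInessential 𝓕 D α f p q)

variable (D)

instance mixedQuiver : Quiver (MixedVertex 𝓕 α D) where
  Hom p q := MixedGen 𝓕 α p.pair q.pair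

variable {D}

/-- A reachable pair as an object of the free category on the generators. -/
def freeObj (p : RPair D) : Paths (MixedVertex 𝓕 α D) :=
  (Paths.of (MixedVertex 𝓕 α D)).obj ⟨p⟩

/-- An extension as a morphism of the free category. -/
def freeExt {p q : RPair D} (e : p ⟶ q) : freeObj 𝓕 α p ⟶ freeObj 𝓕 α q :=
  (Paths.of (MixedVertex 𝓕 α D)).map (X := ⟨p⟩) (Y := ⟨q⟩) (MixedGen.ext e)

/-- An inessential map as a morphism of the free category. -/
def freeMap {p q : RPair D} (f : C(X, X)) (hf : IsInessential 𝓕 D α f p q) :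
    freeObj 𝓕 α p ⟶ freeObj 𝓕 α q :=
  (Paths.of (MixedVertex 𝓕 α D)).map (X := ⟨p⟩) (Y := ⟨q⟩) (MixedGen.map f hf)

variable (D)

/-- The defining relations. The first four say that extensions compose as in the extension category
and inessential maps compose as maps; `square` is the compatibility of inessential maps with
extensions; `flow` says `*H(y) ∘ f = H(x)* ∘ g` on the pair `(x, y)`, for a simple d-homotopy `H`
from `f` to `g` one of which is the identity. -/
inductive MixedRel : HomRel (Paths (MixedVertex 𝓕 α D))
  | ext_id (p : RPair D) : MixedRel (freeExt 𝓕 α (𝟙 p)) (𝟙 (freeObj 𝓕 α p))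
  | ext_comp {p q r : RPair D} (e : p ⟶ q) (e' : q ⟶ r) :
      MixedRel (freeExt 𝓕 α e ≫ freeExt 𝓕 α e') (freeExt 𝓕 α (e ≫ e'))
  | map_id {p : RPair D} (h : IsInessential 𝓕 D α (ContinuousMap.id X) p p) :
      MixedRel (freeMap 𝓕 α (ContinuousMap.id X) h) (𝟙 (freeObj 𝓕 α p))
  | map_comp {p q r : RPair D} (f g : C(X, X)) (hf : IsInessential 𝓕 D α f p q)
      (hg : IsInessential 𝓕 D α g q r) (hgf : IsInessential 𝓕 D α (g.comp f) p r) :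
      MixedRel (freeMap 𝓕 α f hf ≫ freeMap 𝓕 α g hg) (freeMap 𝓕 α (g.comp f) hgf)
  | square {p q : RPair D} (f : C(X, X)) (hd : IsDMap D D f)
      (hp : IsInessential 𝓕 D α f p (p.map f hd)) (hq : IsInessential 𝓕 D α f q (q.map f hd))
      (e : p ⟶ q) :
      MixedRel (freeMap 𝓕 α f hp ≫ freeExt 𝓕 α ((extMap f hd).map e))
        (freeExt 𝓕 α e ≫ freeMap 𝓕 α f hq)
  | flow {p : RPair D} (f g : C(X, X)) (H : C(X × unitInterval, X)) (hH : IsSimpleDHomotopy D H)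
      (h0 : ∀ x, H (x, 0) = f x) (h1 : ∀ x, H (x, 1) = g x)
      (hid : f = ContinuousMap.id X ∨ g = ContinuousMap.id X)
      (hfd : IsDMap D D f) (hgd : IsDMap D D g)
      (hf : IsInessential 𝓕 D α f p (p.map f hfd)) (hg : IsInessential 𝓕 D α g p (p.map g hgd))
      (hr : Nonempty (DPath D (f p.src) (g p.tgt))) :
      MixedRel
        (freeMap 𝓕 α f hf ≫ freeExt 𝓕 α (p := p.map f hfd) (q := ⟨f p.src, g p.tgt, hr⟩)
          (FundHom.refl (f p.src), FundHom.mk (flowPath H hH (h0 p.tgt) (h1 p.tgt))))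
        (freeMap 𝓕 α g hg ≫ freeExt 𝓕 α (p := p.map g hgd) (q := ⟨f p.src, g p.tgt, hr⟩)
          (FundHom.mk (flowPath H hH (h0 p.src) (h1 p.src)), FundHom.refl (g p.tgt)))

/-- The category whose objects are the reachable pairs and whose morphisms are the finite
compositions of inessential maps and extensions, modulo the relations above. -/
abbrev MixedCategory : Type u := CategoryTheory.Quotient (MixedRel 𝓕 α D)

/-- The functor from the extension category. -/
noncomputable def extToMixed : RPair D ⥤ MixedCategory 𝓕 α D where
  obj p := (CategoryTheory.Quotient.functor (MixedRel 𝓕 α D)).obj (freeObj 𝓕 α p)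
  map e := (CategoryTheory.Quotient.functor (MixedRel 𝓕 α D)).map (freeExt 𝓕 α e)
  map_id p := (CategoryTheory.Quotient.sound _ (MixedRel.ext_id p)).trans (CategoryTheory.Functor.map_id _ _)
  map_comp e e' := (CategoryTheory.Quotient.sound _ (MixedRel.ext_comp e e')).symm.trans (Functor.map_comp _ _ _)

/-- The class of morphisms given by the inessential maps. -/
inductive inessentialMorphisms : MorphismProperty (MixedCategory 𝓕 α D)
  | map {p q : RPair D} (f : C(X, X)) (hf : IsInessential 𝓕 D α f p q) :
      inessentialMorphisms ((CategoryTheory.Quotient.functor (MixedRel 𝓕 α D)).map (freeMap 𝓕 α f hf))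

end Mixed

/-! ## Quotient of a category by a class of morphisms -/

section ComponentCategory

variable {C : Type u} [Category.{v} C] (W : MorphismProperty C)

/-- The path components of objects with respect to zig-zags of `W`-morphisms. -/
structure ComponentVertex where
  comp : Quot (fun x y : C => ∃ f : x ⟶ y, W f)

/-- The component of an object. -/
def componentOf (x : C) : ComponentVertex W := ⟨Quot.mk _ x⟩

variable {W} in
lemma componentOf_eq {x y : C} (f : x ⟶ y) (hf : W f) : componentOf W x = componentOf W y :=
  congrArg ComponentVertex.mk (Quot.sound ⟨f, hf⟩)

/-- The generating morphisms from a component `a` to a component `b`: the morphisms of `C` from an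
object of `a` to an object of `b`. -/
structure ComponentGen (a b : ComponentVertex W) where
  src : C
  tgt : C
  hom : src ⟶ tgt
  src_mem : componentOf W src = a
  tgt_mem : componentOf W tgt = b

instance componentQuiver : Quiver (ComponentVertex W) where
  Hom a b := ComponentGen W a b

/-- A morphism of `C` as a morphism of the free category, between any components that contain its
source and its target. -/
def componentHom {a b : ComponentVertex W} {x y : C} (f : x ⟶ y) (hx : componentOf W x = a)
    (hy : componentOf W y = b) :
    (Paths.of (ComponentVertex W)).obj a ⟶ (Paths.of (ComponentVertex W)).obj b :=
  (Paths.of (ComponentVertex W)).map (ComponentGen.mk x y f hx hy)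

/-- The defining relations: compositions and identities are as in `C`, and the morphisms in `W` are
identities. -/
inductive ComponentRel : HomRel (Paths (ComponentVertex W))
  | id (x : C) : ComponentRel (componentHom W (𝟙 x) rfl rfl) (𝟙 _)
  | comp {x y z : C} (f : x ⟶ y) (g : y ⟶ z) :
      ComponentRel (componentHom W f rfl rfl ≫ componentHom W g rfl rfl)
        (componentHom W (f ≫ g) rfl rfl)
  | collapse {x y : C} (f : x ⟶ y) (hf : W f) :
      ComponentRel (componentHom W f rfl (componentOf_eq f hf).symm) (𝟙 _)

/-- The quotient category `C / W`: objects are the components, and the morphisms of `W` become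
identities. -/
abbrev ComponentCategory : Type u := CategoryTheory.Quotient (ComponentRel W)

/-- The quotient functor. -/
def toComponentCategory : C ⥤ ComponentCategory W where
  obj x := (CategoryTheory.Quotient.functor (ComponentRel W)).obj
    ((Paths.of (ComponentVertex W)).obj (componentOf W x))
  map f := (CategoryTheory.Quotient.functor (ComponentRel W)).map (componentHom W f rfl rfl)
  map_id x := (CategoryTheory.Quotient.sound _ (ComponentRel.id x)).trans (CategoryTheory.Functor.map_id _ _)
  map_comp f g := (CategoryTheory.Quotient.sound _ (ComponentRel.comp f g)).symm.trans (Functor.map_comp _ _ _)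

end ComponentCategory

/-! ## Pair component categories -/

section PairComponents

variable {X : Type u} [TopologicalSpace X] (𝓕 : EquivalenceFamily.{u}) (α : Flavour)
  (D : DStructure X)

/-- The pair component category of a d-space. -/
abbrev PairComponentCategory : Type u := ComponentCategory (inessentialMorphisms 𝓕 α D)

/-- The canonical functor from the extension category to the pair component category. -/
noncomputable def pairComponent : RPair D ⥤ PairComponentCategory 𝓕 α D :=
  extToMixed 𝓕 α D ⋙ toComponentCategory (inessentialMorphisms 𝓕 α D)

end PairComponents

/-! ## The directed circle and the directed torus -/

/-- The directed circle: d-paths are the images of the non-decreasing paths under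
`t ↦ exp (i t)`. -/
noncomputable def dCircle : DStructure Circle where
  dpaths := {γ | ∃ g : C(unitInterval, ℝ), Monotone g ∧ γ = Circle.exp.comp g}
  const_mem x := by
    refine ⟨ContinuousMap.const _ (Complex.arg x), fun _ _ _ => le_rfl, ?_⟩
    ext t
    simp [Circle.exp_arg]
  trans_mem {x y z} p q hp hq := by
    obtain ⟨g, hg, hpg⟩ := hp
    obtain ⟨h, hh, hqh⟩ := hq
    have hp' : ∀ t, p t = Circle.exp (g t) := fun t => congrArg (fun k => k t) hpg
    have hq' : ∀ t, q t = Circle.exp (h t) := fun t => congrArg (fun k => k t) hqh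
    obtain ⟨m, hm⟩ := Circle.exp_eq_exp.1
      (((hp' 1).symm.trans p.target).trans (q.source.symm.trans (hq' 0)))
    let a : Path (g 0) (g 1) := ⟨g, rfl, rfl⟩
    let b : Path (g 1) (h 1 + m * (2 * Real.pi)) :=
      { toFun := fun t => h t + m * (2 * Real.pi)
        continuous_toFun := by fun_prop
        source' := hm.symm
        target' := rfl }
    refine ⟨(a.trans b).toContinuousMap, monotone_path_trans a b hg
      (fun s t hst => add_le_add_left (hh hst) _), ?_⟩
    ext t
    congr 1
    change (p.trans q) t = Circle.exp ((a.trans b) t)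
    rw [Path.trans_apply, Path.trans_apply]
    split_ifs
    · exact hp' _
    · rw [hq']
      exact Circle.exp_eq_exp.2 ⟨-m, by simp [b]⟩
  reparam_mem := by
    rintro γ ⟨g, hg, rfl⟩ φ hφ
    exact ⟨g.comp φ, hg.comp hφ, rfl⟩

/-- The directed `n`-torus, the product of `n` directed circles. -/
noncomputable def dTorus (n : ℕ) : DStructure (Fin n → Circle) := DStructure.pi fun _ => dCircle

/-- The projection of the `n`-torus to its `i`-th circle. -/
noncomputable def torusProj (n : ℕ) (i : Fin n) : C(Fin n → Circle, Circle) := ContinuousMap.eval i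

lemma isDMap_torusProj (n : ℕ) (i : Fin n) : IsDMap (dTorus n) dCircle (torusProj n i) :=
  fun _ hγ => hγ i

/-! ## The model category -/

/-- The bit vectors of length `n`; the bit `false` (`0`) stands for `Δ`, `true` (`1`) for `Γ`. -/
structure BitVec01 (n : ℕ) where
  bit : Fin n → Bool

/-- A morphism `d ⟶ d'` is a vector of natural numbers whose `i`-th coordinate is positive whenever
`(dᵢ, dᵢ') = (1, 0)`; composition is coordinatewise addition. -/
instance bitCategory (n : ℕ) : Category (BitVec01 n) where
  Hom d d' := {k : Fin n → ℕ // ∀ i, d.bit i = true → d'.bit i = false → 0 < k i}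
  id d := ⟨0, fun i h h' => by simp [h] at h'⟩
  comp {d d' d''} k l := ⟨k.1 + l.1, fun i h h'' => by
    cases h' : d'.bit i with
    | false => exact Nat.add_pos_left (k.2 i h h') _
    | true => exact Nat.add_pos_right _ (l.2 i h' h'')⟩
  id_comp k := Subtype.ext (zero_add k.1)
  comp_id k := Subtype.ext (add_zero k.1)
  assoc k l m := Subtype.ext (add_assoc k.1 l.1 m.1)

/-- A functor is an isomorphism of categories. -/
def IsIsoOfCategories {A : Type u} {B : Type v} [Category A] [Category B] (F : A ⥤ B) : Prop :=
  ∃ G : B ⥤ A, F ⋙ G = 𝟭 A ∧ G ⋙ F = 𝟭 B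

/-! ## Lengths of classes of d-paths on directed tori -/

/-! On the universal covering, a class of d-paths with given ends is the same as its vector of
angular lengths. Two monotone lifts with the same ends are joined by straight-line interpolation,
which stays monotone (`TorusChart.hom_ext`), and every non-negative length vector compatible with
the ends is realised (`TorusChart.exists_len_eq`). An extension of pairs is thus a pair of length
vectors, and identities between extensions become arithmetic.

The rigid part is the shape of inessential maps. Such a map is the end of a flow from or to the
identity, so it has a lift `F` to `ℝⁿ` that commutes with translations by `2π` in each coordinate.
Surjectivity on `π₀` of trace spaces says that `F` reflects the product order. Translating the other
coordinates far up shows that each coordinate of `F` reflects the order by itself, and continuity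
then shows that it depends on its own coordinate only (`TorusChart.exists_shift_of_isPsp`). Hence an
inessential map is a product of shifts `z ↦ z * exp (δ z)` with strictly increasing lifts.
Conversely, such products are inessential as soon as the signs of the angles suit the flavour, by
scaling `δ` (`TorusChart.isInessential_shiftMap`).

Let the arc of a pair be the angle in `[0, 2π)` from source to target, in each coordinate. An
extension prolongs the arc of its domain at both ends, and the result exceeds the arc of its
codomain by a number of full turns, the degree. Degrees add under composition, and are positive
where the bit drops from `1` to `0`. Shifts change lengths and arcs by displacements that cancel,
and the flow relation equates extensions of equal degree, so bits and degree descend to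
`TorusChart.componentDegree`.

For the converse, rotations and the flow relation make any extension act at the target only, with
source `1` (`TorusChart.exists_based_sameHom`). A shift that fixes `1` can push a target forward
inside `(0, 2π)`, so extensions of that kind become identities (`TorusChart.sameHom_id_of_move`).
Every extension therefore agrees with a standard one of the same degree
(`TorusChart.sameHom_section`), and the standard extensions give an inverse of the degree functor.

Charts let one argument serve `T^n` and, with `n = 1`, the circle; the product decomposition is read
off from the bit vectors. Objects of quotient categories are often equal only propositionally, so
morphisms are compared by `SameHom`. -/

/-- An identification of a d-space with the directed `n`-torus. -/
structure TorusChart {X : Type u} [TopologicalSpace X] (D : DStructure X) (n : ℕ) where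
  toHomeomorph : X ≃ₜ (Fin n → Circle)
  mem_dpaths_iff : ∀ γ : C(unitInterval, X), γ ∈ D.dpaths ↔ ∀ i, ∃ g : C(unitInterval, ℝ),
    Monotone g ∧ ∀ t, toHomeomorph (γ t) i = Circle.exp (g t)

/-- The exponential is a covering, so a lift of a constant map on a connected space is constant.
This is the source of all the rigidity of angles below. -/
lemma Circle.const_of_exp_const {A : Type*} [TopologicalSpace A] [PreconnectedSpace A] {f : A → ℝ}
    (hf : Continuous f) {z : Circle} (h : ∀ a, Circle.exp (f a) = z) (a b : A) : f a = f b :=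
  Circle.isCoveringMap_exp.const_of_comp hf (fun a b => (h a).trans (h b).symm) a b

lemma Circle.lift_sub_lift {A : Type*} [TopologicalSpace A] [PreconnectedSpace A] {f g : A → ℝ}
    (hf : Continuous f) (hg : Continuous g) (h : ∀ a, Circle.exp (f a) = Circle.exp (g a))
    (a b : A) : f a - f b = g a - g b := by
  have := Circle.const_of_exp_const (hf.sub hg) (z := 1)
    (fun a => by rw [Pi.sub_apply, Circle.exp_sub, h, div_self']) a b
  simp only [Pi.sub_apply] at this
  linarith

/-- Lifting of homotopies along the exponential. -/
lemma Circle.exists_lift_homotopy {A : Type*} [TopologicalSpace A] (K : A × unitInterval → Circle)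
    (hK : Continuous K) (f : A → ℝ) (hf : Continuous f) (h : ∀ a, K (a, 0) = Circle.exp (f a)) :
    ∃ Θ : A × unitInterval → ℝ, Continuous Θ ∧ (∀ p, K p = Circle.exp (Θ p)) ∧
      ∀ a, Θ (a, 0) = f a := by
  let H : C(unitInterval × A, Circle) := ⟨fun p => K (p.2, p.1), by fun_prop⟩
  refine ⟨fun p => Circle.isCoveringMap_exp.liftHomotopy H ⟨f, hf⟩ h (p.2, p.1), by fun_prop,
    fun p => ?_, fun a => Circle.isCoveringMap_exp.liftHomotopy_zero H ⟨f, hf⟩ h a⟩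
  exact (congrFun (Circle.isCoveringMap_exp.liftHomotopy_lifts H ⟨f, hf⟩ h) (p.2, p.1)).symm

section Length

variable {X : Type u} [TopologicalSpace X] {D : DStructure X} {n : ℕ} (c : TorusChart D n)

namespace TorusChart

/-- The `i`-th circle coordinate. -/
noncomputable def coord (x : X) (i : Fin n) : Circle := c.toHomeomorph x i

@[fun_prop]
lemma continuous_coord (i : Fin n) : Continuous fun x => c.coord x i :=
  (continuous_apply i).comp c.toHomeomorph.continuous

/-- The point with given angular coordinates. -/
noncomputable def point (u : Fin n → ℝ) : X := c.toHomeomorph.symm fun i => Circle.exp (u i)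

@[simp]
lemma coord_point (u : Fin n → ℝ) (i : Fin n) : c.coord (c.point u) i = Circle.exp (u i) := by
  simp [coord, point]

@[fun_prop]
lemma continuous_point : Continuous c.point :=
  c.toHomeomorph.symm.continuous.comp (by fun_prop)

lemma coord_ext {x y : X} (h : ∀ i, c.coord x i = c.coord y i) : x = y :=
  c.toHomeomorph.injective (funext h)

lemma exists_point (x : X) : ∃ u, c.point u = x :=
  ⟨fun i => Complex.arg (c.coord x i), c.coord_ext fun i => by simp [Circle.exp_arg]⟩

lemma exists_lift {x y : X} (p : DPath D x y) (i : Fin n) : ∃ g : C(unitInterval, ℝ),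
    Monotone g ∧ ∀ t, c.coord (p.1 t) i = Circle.exp (g t) :=
  (c.mem_dpaths_iff _).1 p.2 i

/-- The angular length of a d-path. -/
noncomputable def pathLen {x y : X} (p : DPath D x y) (i : Fin n) : ℝ :=
  (c.exists_lift p i).choose 1 - (c.exists_lift p i).choose 0

lemma pathLen_eq {x y : X} (p : DPath D x y) (i : Fin n) {g : unitInterval → ℝ}
    (hg : Continuous g) (h : ∀ t, c.coord (p.1 t) i = Circle.exp (g t)) :
    c.pathLen p i = g 1 - g 0 :=
  Circle.lift_sub_lift (c.exists_lift p i).choose.continuous hg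
    (fun t => ((c.exists_lift p i).choose_spec.2 t).symm.trans (h t)) 1 0

lemma pathLen_nonneg {x y : X} (p : DPath D x y) (i : Fin n) : 0 ≤ c.pathLen p i :=
  sub_nonneg.2 ((c.exists_lift p i).choose_spec.1 unitInterval.nonneg')

lemma exp_pathLen {x y : X} (p : DPath D x y) (i : Fin n) :
    c.coord y i = c.coord x i * Circle.exp (c.pathLen p i) := by
  have h0 := (c.exists_lift p i).choose_spec.2 0
  have h1 := (c.exists_lift p i).choose_spec.2 1
  rw [p.1.source] at h0
  rw [p.1.target] at h1
  rw [h0, h1, pathLen, ← Circle.exp_add, add_sub_cancel]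

/-- Homotopy lifting with the whole path space as parameter space, started at a constant angle of
the common source, lifts all d-paths at once and continuously. -/
lemma continuous_pathLen (x y : X) (i : Fin n) :
    Continuous fun p : DPath D x y => c.pathLen p i := by
  have hev : Continuous fun q : DPath D x y × unitInterval => q.1.1 q.2 := by
    have h1 : Continuous fun p : DPath D x y => p.1.toContinuousMap :=
      continuous_induced_dom.comp continuous_subtype_val
    exact ContinuousEval.continuous_eval.comp (h1.prodMap continuous_id)
  obtain ⟨Θ, hΘ, h, -⟩ := Circle.exists_lift_homotopy
    (fun q : DPath D x y × unitInterval => c.coord (q.1.1 q.2) i)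
    ((c.continuous_coord i).comp hev) (fun _ => Complex.arg (c.coord x i)) continuous_const
    (fun p => by simp [Circle.exp_arg, p.1.source])
  have : (fun p : DPath D x y => c.pathLen p i) = fun p => Θ (p, 1) - Θ (p, 0) :=
    funext fun p => c.pathLen_eq p i (g := fun t => Θ (p, t)) (by fun_prop) fun t => h (p, t)
  rw [this]
  fun_prop

/-- The angular length of a trace. -/
noncomputable def traceLen {x y : X} (σ : Trace D x y) (i : Fin n) : ℝ :=
  Quot.lift (fun p => c.pathLen p i) (by
    rintro p q ⟨φ, hm, hs, h⟩
    obtain ⟨g, -, hg⟩ := c.exists_lift p i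
    obtain ⟨h0, h1⟩ := reparam_ends hm hs
    rw [c.pathLen_eq p i g.continuous hg, c.pathLen_eq q i (g := g ∘ φ) (by fun_prop)
      (fun t => by rw [h, hg]; rfl)]
    simp [h0, h1]) σ

/-- The angular length of a class of d-paths. -/
noncomputable def len {x y : X} (σ : FundHom D x y) (i : Fin n) : ℝ :=
  ZerothHomotopy.lift (fun a => c.traceLen a i) (fun a b γ => by
    have hc : Continuous fun a : Trace D x y => c.traceLen a i :=
      continuous_quot_lift _ (c.continuous_pathLen x y i)
    -- The exponential of the length is fixed by the two ends, so the length cannot vary along a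
    -- path of traces.
    have := Circle.const_of_exp_const (hc.comp γ.continuous) (z := c.coord y i / c.coord x i)
      (fun t => by
        obtain ⟨p, hp⟩ := Quot.exists_rep (γ t)
        rw [eq_div_iff_mul_eq', mul_comm, c.exp_pathLen p i, Function.comp_apply, ← hp]
        rfl) 0 1
    simpa using this) σ

@[simp]
lemma len_mk {x y : X} (p : DPath D x y) (i : Fin n) :
    c.len (FundHom.mk p) i = c.pathLen p i := rfl

end TorusChart

lemma FundHom.exists_rep {x y : X} (σ : FundHom D x y) : ∃ p : DPath D x y, FundHom.mk p = σ := by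
  obtain ⟨a, rfl⟩ := ZerothHomotopy.mk_surjective σ
  obtain ⟨p, rfl⟩ := Quot.exists_rep a
  exact ⟨p, rfl⟩

namespace TorusChart

lemma len_nonneg {x y : X} (σ : FundHom D x y) (i : Fin n) : 0 ≤ c.len σ i := by
  obtain ⟨p, rfl⟩ := σ.exists_rep
  exact c.pathLen_nonneg p i

lemma exp_len {x y : X} (σ : FundHom D x y) (i : Fin n) :
    c.coord y i = c.coord x i * Circle.exp (c.len σ i) := by
  obtain ⟨p, rfl⟩ := σ.exists_rep
  exact c.exp_pathLen p i

/-- The d-path with given non-decreasing angular coordinates. -/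
noncomputable def pathOfLift {x y : X} (g : unitInterval → Fin n → ℝ) (hg : Continuous g)
    (hm : Monotone g) (h0 : c.point (g 0) = x) (h1 : c.point (g 1) = y) : DPath D x y :=
  ⟨{ toFun := fun t => c.point (g t)
     continuous_toFun := by fun_prop
     source' := h0
     target' := h1 }, (c.mem_dpaths_iff _).2 fun i => ⟨⟨fun t => g t i, by fun_prop⟩,
      fun s t hst => hm hst i, fun t => c.coord_point (g t) i⟩⟩

lemma len_pathOfLift {x y : X} (g : unitInterval → Fin n → ℝ) (hg : Continuous g)
    (hm : Monotone g) (h0 : c.point (g 0) = x) (h1 : c.point (g 1) = y) (i : Fin n) :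
    c.pathLen (c.pathOfLift g hg hm h0 h1) i = g 1 i - g 0 i :=
  c.pathLen_eq _ i (g := fun t => g t i) (by fun_prop) fun t => c.coord_point (g t) i

lemma exists_len_eq {x y : X} (L : Fin n → ℝ) (hL : ∀ i, 0 ≤ L i)
    (h : ∀ i, c.coord y i = c.coord x i * Circle.exp (L i)) :
    ∃ σ : FundHom D x y, ∀ i, c.len σ i = L i := by
  obtain ⟨u, rfl⟩ := c.exists_point x
  have hm : Monotone fun (t : unitInterval) i => u i + t * L i := by
    intro s t hst i
    have : (s : ℝ) ≤ t := hst
    simpa using mul_le_mul_of_nonneg_right this (hL i)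
  refine ⟨FundHom.mk (c.pathOfLift _ (by fun_prop) hm (by simp)
    (c.coord_ext fun i => by simp [h, Circle.exp_add])), fun i => ?_⟩
  rw [len_mk, len_pathOfLift]
  simp

/-- Lifts of the two paths, normalised to the same start, also have the same end when the lengths
agree. Convex combinations of monotone functions are monotone, so the linear homotopy between the
lifts runs through d-paths with fixed ends. -/
lemma hom_ext {x y : X} {σ τ : FundHom D x y} (h : ∀ i, c.len σ i = c.len τ i) : σ = τ := by
  obtain ⟨p, rfl⟩ := σ.exists_rep
  obtain ⟨q, rfl⟩ := τ.exists_rep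
  choose g hgm hg using c.exists_lift p
  choose k hkm hk using c.exists_lift q
  have hlen : ∀ i, k i 1 - k i 0 = g i 1 - g i 0 := fun i => by
    have := h i
    rw [len_mk, len_mk, c.pathLen_eq p i (g i).continuous (hg i),
      c.pathLen_eq q i (k i).continuous (hk i)] at this
    exact this.symm
  have hexp : ∀ i, Circle.exp (k i 0) = Circle.exp (g i 0) := fun i => by
    rw [← hg, ← hk, p.1.source, q.1.source]
  -- The lift of `q` is translated by `g i 0 - k i 0`, a multiple of `2π` by `hexp`, so that it
  -- starts where the lift of `p` starts.
  let G : unitInterval × unitInterval → Fin n → ℝ := fun s i =>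
    (1 - (s.1 : ℝ)) * g i s.2 + s.1 * (k i s.2 - k i 0 + g i 0)
  have hG : Continuous G := by fun_prop
  have hp : ∀ t, c.point (fun i => g i t) = p.1 t := fun t => c.coord_ext fun i => by simp [hg]
  have hq : ∀ t, c.point (fun i => k i t - k i 0 + g i 0) = q.1 t := fun t =>
    c.coord_ext fun i => by simp [hk, Circle.exp_add, Circle.exp_sub, hexp]
  have hG0 : ∀ s, c.point (G (s, 0)) = x := fun s => by
    rw [← p.1.source, ← hp]
    congr 1; ext i; simp only [G]; ring
  have hG1 : ∀ s, c.point (G (s, 1)) = y := fun s => by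
    rw [← p.1.target, ← hp]
    congr 1; ext i; simp only [G]; rw [hlen]; ring
  have hm : ∀ s, Monotone fun t => G (s, t) := fun s t t' htt i => by
    have h1 : 0 ≤ 1 - (s : ℝ) := sub_nonneg.2 s.2.2
    have h2 : 0 ≤ (s : ℝ) := s.2.1
    have h3 := hgm i htt
    have h4 := hkm i htt
    simp only [G]
    gcongr
  let P : unitInterval → DPath D x y := fun s =>
    c.pathOfLift (fun t => G (s, t)) (by fun_prop) (hm s) (hG0 s) (hG1 s)
  have hP : Continuous P := by
    refine Continuous.subtype_mk (continuous_induced_rng.2 ?_) _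
    exact ContinuousMap.continuous_of_continuous_uncurry _ (c.continuous_point.comp hG)
  refine ZerothHomotopy.sound (x := Trace.mk p) (y := Trace.mk q)
    { toFun := fun s => Trace.mk (P s)
      continuous_toFun := continuous_quot_mk.comp hP
      source' := congrArg Trace.mk (Subtype.ext (Path.ext (funext fun t => ?_)))
      target' := congrArg Trace.mk (Subtype.ext (Path.ext (funext fun t => ?_))) }
  · refine Eq.trans ?_ (hp t)
    change c.point (G (0, t)) = _
    simp [G]
  · refine Eq.trans ?_ (hq t)
    change c.point (G (1, t)) = _
    simp [G]

@[simp]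
lemma len_refl (x : X) (i : Fin n) : c.len (FundHom.refl x : FundHom D x x) i = 0 := by
  refine (c.pathLen_eq (DPath.refl x) i (g := fun _ => Complex.arg (c.coord x i))
    continuous_const fun t => ?_).trans (sub_self _)
  rw [Circle.exp_arg]
  rfl

@[simp]
lemma len_trans {x y z : X} (σ : FundHom D x y) (τ : FundHom D y z) (i : Fin n) :
    c.len (σ.trans τ) i = c.len σ i + c.len τ i := by
  obtain ⟨p, rfl⟩ := σ.exists_rep
  obtain ⟨q, rfl⟩ := τ.exists_rep
  change c.pathLen (p.trans q) i = c.pathLen p i + c.pathLen q i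
  obtain ⟨g, -, hg⟩ := c.exists_lift p i
  obtain ⟨k, -, hk⟩ := c.exists_lift q i
  have hexp : Circle.exp (k 0) = Circle.exp (g 1) := by
    rw [← hg, ← hk, p.1.target, q.1.source]
  let a : Path (g 0) (g 1) := ⟨g, rfl, rfl⟩
  let b : Path (g 1) (k 1 - k 0 + g 1) :=
    { toFun := fun t => k t - k 0 + g 1
      continuous_toFun := by fun_prop
      source' := by simp
      target' := rfl }
  rw [c.pathLen_eq p i g.continuous hg, c.pathLen_eq q i k.continuous hk,
    c.pathLen_eq (p.trans q) i (a.trans b).continuous]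
  · rw [(a.trans b).source, (a.trans b).target]
    ring
  · intro t
    change c.coord ((p.1.trans q.1) t) i = _
    rw [Path.trans_apply, Path.trans_apply]
    split_ifs
    · exact hg _
    · simp [b, hk, Circle.exp_add, Circle.exp_sub, hexp]

end TorusChart

/-- Adding the displacement `θ` along the path to a lift of the path gives a lift of its image. Two
charts and two indices are allowed so that coordinate projections are covered as well as self-maps.
-/
lemma TorusChart.len_map {Y : Type v} [TopologicalSpace Y] {E : DStructure Y} {m : ℕ}
    (b : TorusChart E m) (f : C(X, Y)) (hf : IsDMap D E f) {x y : X} {x' y' : Y} (hx : f x = x')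
    (hy : f y = y') (i : Fin n) (j : Fin m) (θ : X → ℝ) (hθ : Continuous θ)
    (h : ∀ x, b.coord (f x) j = c.coord x i * Circle.exp (θ x)) (σ : FundHom D x y) :
    b.len (FundHom.map f hf hx hy σ) j = c.len σ i + θ y - θ x := by
  obtain ⟨p, rfl⟩ := σ.exists_rep
  obtain ⟨g, -, hg⟩ := c.exists_lift p i
  change b.pathLen (DPath.map f hf hx hy p) j = c.pathLen p i + θ y - θ x
  rw [b.pathLen_eq _ j (g := fun t => g t + θ (p.1 t)) (by fun_prop), c.pathLen_eq p i g.continuous hg,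
    p.1.source, p.1.target]
  · ring
  · intro t
    rw [Circle.exp_add, ← hg, ← h]
    rfl

end Length

/-- The chart of the directed torus. -/
noncomputable def torusChart (n : ℕ) : TorusChart (dTorus n) n where
  toHomeomorph := Homeomorph.refl _
  mem_dpaths_iff _ := forall_congr' fun _ => exists_congr fun _ => and_congr_right fun _ =>
    ⟨fun h t => congrArg (fun k => k t) h, fun h => ContinuousMap.ext h⟩

/-- The chart of the directed circle. -/
noncomputable def circleChart : TorusChart dCircle 1 where
  toHomeomorph := (Homeomorph.funUnique (Fin 1) Circle).symm
  mem_dpaths_iff γ := by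
    constructor
    · rintro ⟨g, hg, h⟩ i
      exact ⟨g, hg, fun t => congrArg (fun k => k t) h⟩
    · intro h
      obtain ⟨g, hg, h⟩ := h 0
      exact ⟨g, hg, ContinuousMap.ext h⟩

/-! ## Angular shifts -/

lemma Circle.angleDiff_eq {z w : Circle} {a : ℝ} (h0 : 0 ≤ a) (h1 : a < 2 * Real.pi)
    (h : w = z * Circle.exp a) : Circle.angleDiff z w = a := by
  refine Circle.exp_injOn_Ico (a := 0) (b := 2 * Real.pi) (by simp)
    ⟨Circle.angleDiff_nonneg _ _, Circle.angleDiff_lt_two_pi _ _⟩ ⟨h0, h1⟩ ?_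
  rw [eq_comm, ← mul_right_inj z, ← h, mul_comm, Circle.exp_angleDiff_mul]

lemma Circle.angleDiff_self (z : Circle) : Circle.angleDiff z z = 0 :=
  Circle.angleDiff_eq le_rfl Real.two_pi_pos (by simp)

lemma Circle.mul_exp_angleDiff (z w : Circle) : z * Circle.exp (Circle.angleDiff z w) = w := by
  rw [mul_comm, Circle.exp_angleDiff_mul]

/-- Periodic functions descend to the circle. -/
lemma Circle.exists_of_periodic (f : ℝ → ℝ) (hf : Continuous f)
    (h : Function.Periodic f (2 * Real.pi)) :
    ∃ δ : C(Circle, ℝ), ∀ s, δ (Circle.exp s) = f s := by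
  have hq : Topology.IsQuotientMap Circle.exp :=
    Circle.isCoveringMap_exp.isQuotientMap Circle.exp_surjective
  -- The argument jumps, but continuity may be tested after composition with the quotient map
  -- `Circle.exp`, where periodicity absorbs the jump.
  refine ⟨⟨fun z => f (Complex.arg z), hq.continuous_iff.2 ?_⟩, fun s => ?_⟩
  · convert hf using 1
    ext s
    obtain ⟨m, hm⟩ := Circle.exp_eq_exp.1 (Circle.exp_arg (Circle.exp s))
    simp only [Function.comp_apply]
    rw [hm]
    exact h.int_mul m s
  · obtain ⟨m, hm⟩ := Circle.exp_eq_exp.1 (Circle.exp_arg (Circle.exp s))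
    simp only [ContinuousMap.coe_mk]
    rw [hm]
    exact h.int_mul m s

/-- A continuous angle function `δ` on the circle such that `z ↦ z * exp (δ z)` lifts to a strictly
increasing function on the line. -/
structure AngularShift where
  angle : C(Circle, ℝ)
  strictMono : StrictMono fun s => s + angle (Circle.exp s)

namespace AngularShift

noncomputable instance : CoeFun AngularShift fun _ => Circle → ℝ := ⟨fun δ => δ.angle⟩

@[fun_prop]
lemma continuous (δ : AngularShift) : Continuous δ := δ.angle.continuous

/-- A shift scaled by a factor in `[0,1]`. -/
noncomputable def scale (δ : AngularShift) (r : unitInterval) : AngularShift where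
  angle := ⟨fun z => r * δ z, by fun_prop⟩
  strictMono s t hst := by
    have h1 : 0 ≤ 1 - (r : ℝ) := sub_nonneg.2 r.2.2
    have h2 : 0 ≤ (r : ℝ) := r.2.1
    have h3 := δ.strictMono hst
    simp only at h3
    change s + r * δ _ < t + r * δ _
    -- The lift `s + r * δ` is the convex combination of `s` and `s + δ` with weights `1 - r` and
    -- `r`.
    rcases h2.eq_or_lt with h | h
    · rw [← h]
      simpa using hst
    · nlinarith [mul_nonneg h1 (sub_nonneg.2 hst.le), mul_pos h (sub_pos.2 h3)]

@[simp]
lemma scale_apply (δ : AngularShift) (r : unitInterval) (z : Circle) : δ.scale r z = r * δ z := rfl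

/-- The rotation by a fixed angle. -/
noncomputable def const (a : ℝ) : AngularShift where
  angle := .const _ a
  strictMono _ _ hst := add_lt_add_left hst a

@[simp]
lemma const_apply (a : ℝ) (z : Circle) : const a z = a := rfl

/-- The strictly increasing lift commutes with translation by `2π`, so it maps `[s, s + 2π)` into
the corresponding interval at the image of `s`. The displaced angle thus stays in `[0, 2π)` and no
full turn has to be added. -/
lemma angleDiff_shift (δ : AngularShift) (z w : Circle) :
    Circle.angleDiff (z * Circle.exp (δ z)) (w * Circle.exp (δ w)) =
      Circle.angleDiff z w + δ w - δ z := by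
  have hw := Circle.mul_exp_angleDiff z w
  obtain ⟨s, rfl⟩ := Circle.exp_surjective z
  rw [← Circle.exp_add] at hw
  have h0 := δ.strictMono.monotone
    (le_add_of_nonneg_right (a := s) (Circle.angleDiff_nonneg (Circle.exp s) w))
  have h1 := δ.strictMono
    (add_lt_add_right (Circle.angleDiff_lt_two_pi (Circle.exp s) w) s)
  simp only [hw, Circle.exp_add_two_pi] at h0 h1
  refine Circle.angleDiff_eq (by linarith) (by linarith) ?_
  rw [Circle.exp_sub, Circle.exp_add, mul_assoc, mul_div_cancel, ← mul_assoc,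
    Circle.mul_exp_angleDiff]

/-- The angle is bounded because the circle is compact, so the lift is onto and an order isomorphism
of the line. Its inverse commutes with translation by `2π`; the displacement of the inverse is
therefore periodic and descends to the circle. -/
lemma exists_inverse (δ : AngularShift) : ∃ ε : AngularShift,
    (∀ z, ε (z * Circle.exp (δ z)) = -δ z) ∧ ∀ z, δ (z * Circle.exp (ε z)) = -ε z := by
  have hφ : Continuous fun s => s + δ (Circle.exp s) := by fun_prop
  have hsurj : Function.Surjective fun s => s + δ (Circle.exp s) := by
    obtain ⟨b, hb⟩ := (isCompact_range δ.continuous).bddBelow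
    obtain ⟨B, hB⟩ := (isCompact_range δ.continuous).bddAbove
    exact hφ.surjective
      (Filter.tendsto_atTop_add_right_of_le _ b Filter.tendsto_id fun s => hb ⟨_, rfl⟩)
      (Filter.tendsto_atBot_add_right_of_ge _ B Filter.tendsto_id fun s => hB ⟨_, rfl⟩)
  let o : ℝ ≃o ℝ := δ.strictMono.orderIsoOfSurjective _ hsurj
  have ho : ∀ s, o s = s + δ (Circle.exp s) := fun s => rfl
  have hper : ∀ s, o.symm (s + 2 * Real.pi) = o.symm s + 2 * Real.pi := fun s => by
    rw [OrderIso.symm_apply_eq, ho, Circle.exp_add_two_pi, add_right_comm, ← ho,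
      OrderIso.apply_symm_apply]
  obtain ⟨ε, hε⟩ := Circle.exists_of_periodic (fun s => o.symm s - s)
    (o.symm.continuous.sub continuous_id) (fun s => by simp only [hper]; ring)
  refine ⟨⟨ε, ?_⟩, fun z => ?_, fun z => ?_⟩
  · simpa [hε] using o.symm.strictMono
  · obtain ⟨s, rfl⟩ := Circle.exp_surjective z
    rw [← Circle.exp_add, ← ho]
    change ε _ = _
    rw [hε, OrderIso.symm_apply_apply, ho]
    ring
  · obtain ⟨s, rfl⟩ := Circle.exp_surjective z
    change δ (_ * Circle.exp (ε _)) = -ε _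
    rw [hε, ← Circle.exp_add, add_sub_cancel]
    have := ho (o.symm s)
    rw [OrderIso.apply_symm_apply] at this
    linarith

end AngularShift

/-! ## Path space preserving maps -/

/-- The trace maps of `f` and `g` are inverse to each other, hence homotopy equivalences, which
belong to every admissible family. -/
lemma isPsp_of_inverse {X : Type u} [TopologicalSpace X] (𝓕 : EquivalenceFamily.{u})
    {D : DStructure X} (f g : C(X, X)) (hf : IsDMap D D f) (hg : IsDMap D D g)
    (hgf : g.comp f = ContinuousMap.id X) (hfg : f.comp g = ContinuousMap.id X) :
    IsPsp 𝓕 D f := by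
  have h1 : ∀ x, g (f x) = x := fun x => congrArg (fun k => k x) hgf
  have h2 : ∀ x, f (g x) = x := fun x => congrArg (fun k => k x) hfg
  refine ⟨hf, fun p => 𝓕.isEquiv_of_homotopyEquiv _ (traceMap g hg (h1 _) (h1 _)) ?_ ?_⟩
  · convert ContinuousMap.Homotopic.refl _
    ext a
    obtain ⟨q, rfl⟩ := Quot.exists_rep a
    exact (congrArg Trace.mk (Subtype.ext (Path.ext (funext fun t => h1 _)))).symm
  · convert ContinuousMap.Homotopic.refl _
    ext a
    obtain ⟨q, rfl⟩ := Quot.exists_rep a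
    exact (congrArg Trace.mk (Subtype.ext (Path.ext (funext fun t => h2 _)))).symm

/-- Apart from being a d-map, this is all that the classification of inessential maps needs from a
path space preserving map; it makes the result independent of the family. -/
lemma IsPsp.surjective_map {X : Type u} [TopologicalSpace X] {𝓕 : EquivalenceFamily.{u}}
    {D : DStructure X} {f : C(X, X)} (h : IsPsp 𝓕 D f) (hf : IsDMap D D f) (p : RPair D) :
    Function.Surjective (FundHom.map (x := p.src) (y := p.tgt) f hf rfl rfl) :=
  (𝓕.bijective_of_isEquiv _ (h.2 p)).2

/-! ## Shifts of the torus -/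

section Shift

variable {X : Type u} [TopologicalSpace X] {D : DStructure X} {n : ℕ} (c : TorusChart D n)

namespace TorusChart

/-- The map that shifts each coordinate by an angular shift. -/
noncomputable def shiftMap (δ : Fin n → AngularShift) : C(X, X) where
  toFun x := c.toHomeomorph.symm fun i => c.coord x i * Circle.exp (δ i (c.coord x i))
  continuous_toFun := c.toHomeomorph.symm.continuous.comp (by fun_prop)

@[simp]
lemma coord_shiftMap (δ : Fin n → AngularShift) (x : X) (i : Fin n) :
    c.coord (c.shiftMap δ x) i = c.coord x i * Circle.exp (δ i (c.coord x i)) :=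
  congrFun (c.toHomeomorph.apply_symm_apply _) i

/-- The flow `(x, t) ↦ x * exp (a t * δ x)`. -/
noncomputable def shiftFlow (δ : Fin n → AngularShift) (a : C(unitInterval, unitInterval)) :
    C(X × unitInterval, X) where
  toFun q := c.toHomeomorph.symm fun i => c.coord q.1 i *
    Circle.exp (a q.2 * δ i (c.coord q.1 i))
  continuous_toFun := c.toHomeomorph.symm.continuous.comp (by fun_prop)

@[simp]
lemma coord_shiftFlow (δ : Fin n → AngularShift) (a : C(unitInterval, unitInterval))
    (q : X × unitInterval) (i : Fin n) :
    c.coord (c.shiftFlow δ a q) i = c.coord q.1 i * Circle.exp (a q.2 * δ i (c.coord q.1 i)) :=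
  congrFun (c.toHomeomorph.apply_symm_apply _) i

lemma level_shiftFlow (δ : Fin n → AngularShift) (a : C(unitInterval, unitInterval))
    (t : unitInterval) : level (c.shiftFlow δ a) t = c.shiftMap fun i => (δ i).scale (a t) :=
  rfl

/-- The lift of the image path increases in two stages: with the time frozen, because a scaled shift
has an increasing lift; with the point frozen, by `h`. -/
lemma shiftFlow_mem_dpaths (δ : Fin n → AngularShift) (a : C(unitInterval, unitInterval))
    (γ : C(unitInterval, X × unitInterval)) (hγ : ContinuousMap.fst.comp γ ∈ D.dpaths)
    (h : ∀ i z, Monotone fun t => (a (γ t).2 : ℝ) * δ i z) :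
    (c.shiftFlow δ a).comp γ ∈ D.dpaths := by
  refine (c.mem_dpaths_iff _).2 fun i => ?_
  obtain ⟨g, hg, hγg⟩ := (c.mem_dpaths_iff _).1 hγ i
  refine ⟨⟨fun t => g t + a (γ t).2 * δ i (Circle.exp (g t)), by fun_prop⟩,
    fun s t hst => ?_, fun t => ?_⟩
  · exact (((δ i).scale (a (γ s).2)).strictMono.monotone (hg hst)).trans
      (add_le_add_right (h i _ hst) _)
  · have : c.coord (γ t).1 i = Circle.exp (g t) := hγg t
    exact (c.coord_shiftFlow δ a (γ t) i).trans (by rw [this, ← Circle.exp_add]; rfl)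

lemma isDMap_shiftMap (δ : Fin n → AngularShift) : IsDMap D D (c.shiftMap δ) := fun γ hγ => by
  have := c.shiftFlow_mem_dpaths δ (.const _ 1) (γ.prodMk (.const _ 1)) hγ
    fun i z _ _ _ => le_rfl
  convert this using 1
  ext t
  exact c.coord_ext fun i => by simp

lemma shiftMap_comp_eq_id {δ ε : Fin n → AngularShift}
    (h : ∀ i z, ε i (z * Circle.exp (δ i z)) = -δ i z) :
    (c.shiftMap ε).comp (c.shiftMap δ) = ContinuousMap.id X := by
  ext x
  exact c.coord_ext fun i => by simp [h]

variable (𝓕 : EquivalenceFamily.{u})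

lemma isPsp_shiftMap (δ : Fin n → AngularShift) : IsPsp 𝓕 D (c.shiftMap δ) := by
  choose ε h1 h2 using fun i => (δ i).exists_inverse
  exact isPsp_of_inverse 𝓕 _ _ (c.isDMap_shiftMap δ) (c.isDMap_shiftMap ε)
    (c.shiftMap_comp_eq_id h1) (c.shiftMap_comp_eq_id h2)

lemma level_shiftFlow_of_eq_zero (δ : Fin n → AngularShift) (a : C(unitInterval, unitInterval))
    {t : unitInterval} (ht : a t = 0) : level (c.shiftFlow δ a) t = ContinuousMap.id X := by
  ext x
  exact c.coord_ext fun i => by simp [level, ht]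

lemma level_shiftFlow_of_eq_one (δ : Fin n → AngularShift) (a : C(unitInterval, unitInterval))
    {t : unitInterval} (ht : a t = 1) : level (c.shiftFlow δ a) t = c.shiftMap δ := by
  ext x
  exact c.coord_ext fun i => by simp [level, ht]

lemma isPsp_level_shiftFlow (δ : Fin n → AngularShift) (a : C(unitInterval, unitInterval))
    (t : unitInterval) : IsPsp 𝓕 D (level (c.shiftFlow δ a) t) := by
  rw [level_shiftFlow]
  exact c.isPsp_shiftMap 𝓕 _

lemma isNeutralInessential_shiftMap (δ : Fin n → AngularShift) :
    IsNeutralInessential 𝓕 D (c.shiftMap δ) :=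
  ⟨c.shiftFlow δ (.id _), fun γ hγ => c.shiftFlow_mem_dpaths δ _ γ hγ.1 fun i z s t _ =>
      le_of_eq (by
        have h : (γ s).2 = (γ t).2 := hγ.2 s t
        simp [h]),
    c.isPsp_level_shiftFlow 𝓕 _ _, c.level_shiftFlow_of_eq_zero _ _ rfl,
    c.level_shiftFlow_of_eq_one _ _ rfl⟩

lemma isSimpleDHomotopy_shiftFlow (δ : Fin n → AngularShift) (a : C(unitInterval, unitInterval))
    (h : ∀ i z, Monotone fun t => (a t : ℝ) * δ i z) :
    IsSimpleDHomotopy D (c.shiftFlow δ a) :=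
  fun γ hγ => c.shiftFlow_mem_dpaths δ a γ hγ.1 fun i z => (h i z).comp hγ.2

lemma isSimpleDHomotopy_of_nonneg {δ : Fin n → AngularShift} (hδ : ∀ i z, 0 ≤ δ i z) :
    IsSimpleDHomotopy D (c.shiftFlow δ (.id _)) :=
  c.isSimpleDHomotopy_shiftFlow δ _ fun i z _ _ hst => mul_le_mul_of_nonneg_right hst (hδ i z)

lemma isSimpleDHomotopy_of_nonpos {δ : Fin n → AngularShift} (hδ : ∀ i z, δ i z ≤ 0) :
    IsSimpleDHomotopy D (c.shiftFlow δ ⟨unitInterval.symm, by fun_prop⟩) :=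
  c.isSimpleDHomotopy_shiftFlow δ _ fun i z s t hst => by
    have : (s : ℝ) ≤ t := hst
    simp only [ContinuousMap.coe_mk, unitInterval.coe_symm_eq]
    nlinarith [hδ i z]

lemma isFutureInessential_shiftMap {δ : Fin n → AngularShift} (hδ : ∀ i z, 0 ≤ δ i z) :
    IsFutureInessential 𝓕 D (c.shiftMap δ) :=
  ⟨_, c.isSimpleDHomotopy_of_nonneg hδ, c.isPsp_level_shiftFlow 𝓕 _ _,
    c.level_shiftFlow_of_eq_zero _ _ rfl, c.level_shiftFlow_of_eq_one _ _ rfl⟩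

lemma isPastInessential_shiftMap {δ : Fin n → AngularShift} (hδ : ∀ i z, δ i z ≤ 0) :
    IsPastInessential 𝓕 D (c.shiftMap δ) :=
  ⟨_, c.isSimpleDHomotopy_of_nonpos hδ, c.isPsp_level_shiftFlow 𝓕 _ _,
    c.level_shiftFlow_of_eq_one _ _ (by simp), c.level_shiftFlow_of_eq_zero _ _ (by simp)⟩

/-- The shifts with angles of the sign that the flavour requires are inessential. -/
lemma isInessential_shiftMap {α : Flavour} {δ : Fin n → AngularShift}
    (hδ : α ≠ .past → ∀ i z, 0 ≤ δ i z) (hδ' : α = .past → ∀ i z, δ i z ≤ 0) {p q : RPair D}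
    (hs : c.shiftMap δ p.src = q.src) (ht : c.shiftMap δ p.tgt = q.tgt) :
    IsInessential 𝓕 D α (c.shiftMap δ) p q := by
  refine ⟨hs, ht, ?_⟩
  cases α with
  | future => exact c.isFutureInessential_shiftMap 𝓕 (hδ (by simp))
  | past => exact c.isPastInessential_shiftMap 𝓕 (hδ' rfl)
  | neutral => exact c.isNeutralInessential_shiftMap 𝓕 δ
  | total =>
    refine ⟨c.isFutureInessential_shiftMap 𝓕 (hδ (by simp)), ?_⟩
    -- The return map of the total flavour is the inverse shift. Its angles are non-positive, and
    -- the composite is the identity on the nose.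
    choose ε h1 h2 using fun i => (δ i).exists_inverse
    have hε : ∀ i z, ε i z ≤ 0 := fun i z => by
      have := hδ (by simp) i (z * Circle.exp (ε i z))
      rw [h2] at this
      linarith
    have hid := c.shiftMap_comp_eq_id h1
    refine ⟨c.shiftMap ε, c.isPastInessential_shiftMap 𝓕 hε,
      (c.isDMap_shiftMap ε).comp (c.isDMap_shiftMap δ), by rw [hid]; rfl, by rw [hid]; rfl,
      𝓕.isHomotopicToId_of_homotopic _ ?_⟩
    convert ContinuousMap.Homotopic.refl _
    ext a
    obtain ⟨r, rfl⟩ := Quot.exists_rep a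
    exact (congrArg Trace.mk (Subtype.ext (Path.ext (funext fun t =>
      congrArg (fun k => k (r.1 t)) hid)))).symm

/-- Any two points of a torus are joined by a d-path. -/
lemma nonempty_dpath (c : TorusChart D n) (x y : X) : Nonempty (DPath D x y) := by
  obtain ⟨σ, -⟩ := c.exists_len_eq (x := x) (y := y)
    (fun i => Circle.angleDiff (c.coord x i) (c.coord y i))
    (fun i => Circle.angleDiff_nonneg _ _) fun i => (Circle.mul_exp_angleDiff _ _).symm
  exact ⟨σ.exists_rep.choose⟩

/-- A path space preserving map with a lift to the universal covering is a product of shifts. -/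
lemma exists_shift_of_isPsp {f : C(X, X)} (hf : IsPsp 𝓕 D f) (θ : Fin n → C(X, ℝ))
    (hθ : ∀ x i, c.coord (f x) i = c.coord x i * Circle.exp (θ i x)) :
    ∃ δ : Fin n → AngularShift, f = c.shiftMap δ := by
  let F : (Fin n → ℝ) → Fin n → ℝ := fun u i => u i + θ i (c.point u)
  have hF : ∀ i, Continuous fun u => F u i := fun i => by fun_prop
  -- The class of length `F v - F u` between the image points has a preimage by surjectivity on
  -- `π₀`. The length of that preimage is `v i - u i` in each coordinate, and lengths are
  -- non-negative.
  have reflects : ∀ u v, (∀ i, F u i ≤ F v i) → ∀ i, u i ≤ v i := fun u v h i => by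
    obtain ⟨σ, hσ⟩ := c.exists_len_eq (x := f (c.point u)) (y := f (c.point v))
      (fun i => F v i - F u i) (fun i => sub_nonneg.2 (h i)) fun i => by
        simp only [hθ, coord_point, ← Circle.exp_add, F]
        congr 1
        ring
    obtain ⟨τ, hτ⟩ := hf.surjective_map hf.1 ⟨_, _, c.nonempty_dpath (c.point u) (c.point v)⟩ σ
    have h1 := c.len_map c f hf.1 rfl rfl i i (θ i) (θ i).continuous (fun x => hθ x i) τ
    rw [hτ, hσ] at h1
    have := c.len_nonneg τ i
    simp only [F] at h1
    linarith
  -- Adding full turns to the other coordinates of `v` does not move the point, so it leaves the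
  -- displacement alone and makes the other inequalities hold for free.
  have reflects_coord : ∀ u v i, F u i ≤ F v i → u i ≤ v i := fun u v i h => by
    obtain ⟨N, hN⟩ : ∃ N : ℕ, ∀ j, F u j ≤ F v j + N * (2 * Real.pi) := by
      have : ∀ᶠ N : ℕ in Filter.atTop, ∀ j, F u j ≤ F v j + N * (2 * Real.pi) :=
        Filter.eventually_all.2 fun j =>
          (Filter.tendsto_atTop_add_const_left _ _ (tendsto_natCast_atTop_atTop.atTop_mul_const
            Real.two_pi_pos)).eventually_ge_atTop _
      exact this.exists
    let v' : Fin n → ℝ := fun j => if j = i then v j else v j + N * (2 * Real.pi)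
    have hv' : c.point v' = c.point v := c.coord_ext fun j => by
      simp only [coord_point, v']
      split_ifs
      · rfl
      · rw [Circle.exp_add, ← Int.cast_natCast, Circle.exp_int_mul_two_pi, mul_one]
    have := reflects u v' (fun j => ?_) i
    · simpa [v'] using this
    · simp only [F, hv'] at hN h ⊢
      by_cases hj : j = i
      · subst hj
        simpa [v'] using h
      · have := hN j
        simp only [v', hj, if_false]
        linarith
  -- If this failed, it would still fail after raising all coordinates of `v` by a small `ε > 0`;
  -- then `reflects_coord` would give `v i + ε ≤ u i = v i`.
  have le_of_eq_coord : ∀ u v i, u i = v i → F u i ≤ F v i := fun u v i huv => by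
    by_contra! hlt
    have hc : Continuous fun ε : ℝ => F (fun j => v j + ε) i := by fun_prop
    have : ∀ᶠ ε in nhdsWithin (0 : ℝ) (Set.Ioi 0), F (fun j => v j + ε) i < F u i :=
      (hc.continuousAt.eventually_lt_const (by simpa using hlt)).filter_mono nhdsWithin_le_nhds
    obtain ⟨ε, h1, h2⟩ := (this.and self_mem_nhdsWithin).exists
    have := reflects_coord (fun j => v j + ε) u i h1.le
    have : 0 < ε := h2
    linarith
  -- The `i`-th displacement depends on the `i`-th coordinate only, so it can be read off on the
  -- diagonal.
  let δ : Fin n → C(Circle, ℝ) := fun i =>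
    ⟨fun z => θ i (c.toHomeomorph.symm fun _ => z),
      (θ i).continuous.comp (c.toHomeomorph.symm.continuous.comp (by fun_prop))⟩
  have hδ : ∀ i s, δ i (Circle.exp s) = θ i (c.point fun _ => s) := fun i s => rfl
  refine ⟨fun i => ⟨δ i, fun s t hst => ?_⟩, ?_⟩
  · by_contra! h
    exact absurd (reflects_coord (fun _ => t) (fun _ => s) i h) (not_le.2 hst)
  · ext x
    refine c.coord_ext fun i => ?_
    obtain ⟨u, rfl⟩ := c.exists_point x
    rw [hθ, coord_shiftMap]
    congr 2
    change _ = δ i _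
    rw [coord_point, hδ]
    have := le_antisymm (le_of_eq_coord u (fun _ => u i) i rfl) (le_of_eq_coord (fun _ => u i) u i rfl)
    simp only [F] at this
    linarith

/-- The displacement `H (x, t) / x` starts at `1`, so it lifts to real angles starting at `0`. The
angles at time `1` provide the lift needed for `exists_shift_of_isPsp`. -/
lemma exists_shift_of_flow (H : C(X × unitInterval, X)) (h0 : level H 0 = ContinuousMap.id X)
    (h1 : IsPsp 𝓕 D (level H 1)) : ∃ δ : Fin n → AngularShift, level H 1 = c.shiftMap δ := by
  have hx : ∀ x, H (x, 0) = x := fun x => congrArg (fun k => k x) h0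
  choose Θ hc hΘ _ using fun i => Circle.exists_lift_homotopy
    (fun q : X × unitInterval => c.coord (H q) i / c.coord q.1 i) (by fun_prop) (fun _ => 0)
    continuous_const fun x => by simp [hx]
  exact c.exists_shift_of_isPsp 𝓕 h1 (fun i => ⟨fun x => Θ i (x, 1), by fun_prop⟩)
    fun x i => by
      change c.coord (H (x, 1)) i = c.coord x i * Circle.exp (Θ i (x, 1))
      rw [← hΘ, mul_div_cancel]

/-- Inessential maps of the torus are products of shifts. -/
lemma exists_shift_of_isInessential {α : Flavour} {f : C(X, X)} {p q : RPair D}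
    (hf : IsInessential 𝓕 D α f p q) : ∃ δ : Fin n → AngularShift, f = c.shiftMap δ := by
  have future : IsFutureInessential 𝓕 D f → ∃ δ : Fin n → AngularShift, f = c.shiftMap δ := by
    rintro ⟨H, -, hpsp, h0, rfl⟩
    exact c.exists_shift_of_flow 𝓕 H h0 (hpsp 1)
  obtain ⟨-, -, hf⟩ := hf
  cases α with
  | future => exact future hf
  | past =>
    obtain ⟨H, -, hpsp, rfl, h1⟩ := hf
    -- Time is reversed. The directedness of the flow may be lost, but only the level maps at the
    -- two ends and continuity matter here.
    let H' : C(X × unitInterval, X) := ⟨fun q => H (q.1, unitInterval.symm q.2), by fun_prop⟩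
    have e0 : level H' 0 = level H 1 := by ext x; simp [level, H']
    have e1 : level H' 1 = level H 0 := by ext x; simp [level, H']
    obtain ⟨δ, hδ⟩ := c.exists_shift_of_flow 𝓕 H' (e0.trans h1) (e1 ▸ hpsp 0)
    exact ⟨δ, e1.symm.trans hδ⟩
  | neutral =>
    obtain ⟨H, -, hpsp, h0, rfl⟩ := hf
    exact c.exists_shift_of_flow 𝓕 H h0 (hpsp 1)
  | total => exact future hf.1

end TorusChart

end Shift

/-! ## Equality of morphisms with different sources and targets -/

/-- Two morphisms are equal, their sources and targets being equal as well. -/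
inductive SameHom {C : Type*} [Category* C] :
    ∀ {a b a' b' : C}, (a ⟶ b) → (a' ⟶ b') → Prop
  | refl {a b : C} (f : a ⟶ b) : SameHom f f

namespace SameHom

variable {C : Type*} [Category* C] {a b a' b' a'' b'' : C}

lemma of_eq {f g : a ⟶ b} (h : f = g) : SameHom f g := h ▸ refl f

lemma symm {f : a ⟶ b} {g : a' ⟶ b'} (h : SameHom f g) : SameHom g f := by
  cases h
  exact refl f

lemma trans {f : a ⟶ b} {g : a' ⟶ b'} {k : a'' ⟶ b''} (h : SameHom f g) (h' : SameHom g k) :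
    SameHom f k := by
  cases h
  exact h'

lemma comp {d d' : C} {f : a ⟶ b} {f' : a' ⟶ b'} {g : b ⟶ d} {g' : b' ⟶ d'} (h : SameHom f f')
    (h' : SameHom g g') : SameHom (f ≫ g) (f' ≫ g') := by
  cases h
  cases h'
  exact refl _

lemma src_eq {f : a ⟶ b} {g : a' ⟶ b'} (h : SameHom f g) : a = a' := by
  cases h
  rfl

lemma tgt_eq {f : a ⟶ b} {g : a' ⟶ b'} (h : SameHom f g) : b = b' := by
  cases h
  rfl

lemma eq {f g : a ⟶ b} (h : SameHom f g) : f = g := by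
  cases h
  rfl

lemma heq {f : a ⟶ b} {g : a' ⟶ b'} (h : SameHom f g) : f ≍ g := by
  cases h
  rfl

lemma eq_eqToHom {f : a ⟶ b} {g : a' ⟶ b'} (h : SameHom f g) (ha : a = a') (hb : b' = b) :
    f = eqToHom ha ≫ g ≫ eqToHom hb := by
  cases h
  simp

lemma eqToHom_comp_comp {f : a ⟶ b} (ha : a' = a) (hb : b = b') :
    SameHom (eqToHom ha ≫ f ≫ eqToHom hb) f := by
  subst ha hb
  simpa using refl f

lemma map {B : Type*} [Category* B] (F : C ⥤ B) {f : a ⟶ b} {g : a' ⟶ b'} (h : SameHom f g) :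
    SameHom (F.map f) (F.map g) := by
  cases h
  exact refl _

lemma of_functor_eq {B : Type*} [Category* B] {F G : C ⥤ B} (h : F = G) (f : a ⟶ b) :
    SameHom (F.map f) (G.map f) := h ▸ refl _

lemma comp_id {d : C} {f : a ⟶ b} {g : b ⟶ d} {k : a' ⟶ b'} (h : SameHom f k)
    (hg : SameHom g (𝟙 b)) : SameHom (f ≫ g) k :=
  (((refl f).comp hg).trans (of_eq (Category.comp_id f))).trans h

lemma id_comp {d : C} {f : a ⟶ b} {g : b ⟶ d} {k : a' ⟶ b'} (h : SameHom g k)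
    (hf : SameHom f (𝟙 b)) : SameHom (f ≫ g) k :=
  ((hf.comp (refl g)).trans (of_eq (Category.id_comp g))).trans h

lemma id_of_id {f : a ⟶ b} {d : C} (hf : SameHom f (𝟙 d)) : SameHom f (𝟙 b) := by
  cases hf
  exact refl _

lemma src_id_of_id {f : a ⟶ b} {d : C} (hf : SameHom f (𝟙 d)) : SameHom f (𝟙 a) := by
  cases hf
  exact refl _

end SameHom

/-! ## Functors on component categories -/

section ComponentLift

variable {C : Type u} [Category.{v} C] {W : MorphismProperty C} {B : Type*} [Category* B]

lemma Paths.lift_map_of {V : Type*} [Quiver V] {B : Type*} [Category* B] (φ : V ⥤q B) {x y : V}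
    (e : x ⟶ y) : (Paths.lift φ).map ((Paths.of V).map e) = φ.map e :=
  Paths.lift_toPath φ e

lemma Paths.functor_ext_of_sameHom {V : Type*} [Quiver V] {F G : Paths V ⥤ B}
    (h_obj : ∀ a, F.obj a = G.obj a)
    (h : ∀ (a b : V) (e : a ⟶ b), SameHom (F.map ((Paths.of V).map e))
      (G.map ((Paths.of V).map e))) : F = G :=
  Paths.ext_functor (funext h_obj) fun a b e => (h a b e).eq_eqToHom _ _

variable (W) in
lemma componentHom_collapse {a b : ComponentVertex W} {x y : C} (f : x ⟶ y) (hf : W f)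
    (hx : componentOf W x = a) (hy : componentOf W y = b) (hab : a = b) :
    SameHom ((CategoryTheory.Quotient.functor (ComponentRel W)).map (componentHom W f hx hy))
      (𝟙 ((CategoryTheory.Quotient.functor (ComponentRel W)).obj a)) := by
  subst hx hab
  exact .of_eq (CategoryTheory.Quotient.sound _ (ComponentRel.collapse f hf))

/-- The quotient functor maps the morphisms of `W` to identities. -/
lemma toComponentCategory_map_sameHom {x y : C} (f : x ⟶ y) (hf : W f) :
    SameHom ((toComponentCategory W).map f) (𝟙 ((toComponentCategory W).obj x)) :=
  componentHom_collapse W f hf rfl rfl (componentOf_eq f hf)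

/-- The functor on the component category induced by a functor that maps `W` to identities. -/
def componentLift (F : C ⥤ B)
    (h : ∀ {x y : C} (f : x ⟶ y), W f → SameHom (F.map f) (𝟙 (F.obj x))) :
    ComponentCategory W ⥤ B :=
  CategoryTheory.Quotient.lift _
    (Paths.lift
      -- A morphism of `W` maps to an identity, so its ends have equal images and the object map is
      -- well defined on components.
      { obj := fun a => Quot.lift F.obj (fun _ _ ⟨f, hf⟩ => (h f hf).tgt_eq.symm) a.comp
        map := fun {a b} (g : ComponentGen W a b) =>
          eqToHom (by obtain ⟨x, y, f, rfl, rfl⟩ := g; rfl) ≫ F.map g.hom ≫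
          eqToHom (by obtain ⟨x, y, f, rfl, rfl⟩ := g; rfl) }) (by
    rintro _ _ _ _ (x | ⟨f, g⟩ | ⟨f, hf⟩) <;> apply SameHom.eq
    · rw [componentHom, Paths.lift_map_of]
      refine SameHom.eqToHom_comp_comp _ _ |>.trans (.of_eq (F.map_id _)) |>.trans ?_
      rw [CategoryTheory.Functor.map_id]
      exact .refl _
    · rw [Functor.map_comp]
      simp only [componentHom, Paths.lift_map_of]
      refine ((SameHom.eqToHom_comp_comp _ _).comp (SameHom.eqToHom_comp_comp _ _)).trans
        (SameHom.trans ?_ (SameHom.eqToHom_comp_comp _ _).symm)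
      exact .of_eq (F.map_comp f g).symm
    · rw [componentHom, Paths.lift_map_of]
      refine SameHom.eqToHom_comp_comp _ _ |>.trans (h f hf) |>.trans ?_
      rw [CategoryTheory.Functor.map_id]
      exact .refl _)

lemma toComponentCategory_comp_componentLift (F : C ⥤ B)
    (h : ∀ {x y : C} (f : x ⟶ y), W f → SameHom (F.map f) (𝟙 (F.obj x))) :
    toComponentCategory W ⋙ componentLift F h = F := by
  refine CategoryTheory.Functor.hext (fun x => rfl) fun x y f => ?_
  change (Paths.lift _).map (componentHom W f rfl rfl) ≍ _
  rw [componentHom, Paths.lift_map_of]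
  exact (SameHom.eqToHom_comp_comp _ _).heq

lemma componentCategory_functor_ext {F G : ComponentCategory W ⥤ B}
    (h : toComponentCategory W ⋙ F = toComponentCategory W ⋙ G) : F = G := by
  refine CategoryTheory.Quotient.lift_unique' _ _ _ (Paths.functor_ext_of_sameHom ?_ ?_)
  · rintro ⟨a⟩
    obtain ⟨x, rfl⟩ := Quot.exists_rep a
    exact Functor.congr_obj h x
  · rintro _ _ ⟨x, y, f, rfl, rfl⟩
    exact SameHom.of_functor_eq h f

end ComponentLift

/-! ### Functors and relations on pair component categories. -/

section PairLift

variable {X : Type u} [TopologicalSpace X] {𝓕 : EquivalenceFamily.{u}} {α : Flavour}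
  {D : DStructure X} {B : Type*} [Category* B]

variable (𝓕 α) in
/-- An inessential map as a morphism of the mixed category. -/
def mixedMap {p q : RPair D} (f : C(X, X)) (hf : IsInessential 𝓕 D α f p q) :
    (extToMixed 𝓕 α D).obj p ⟶ (extToMixed 𝓕 α D).obj q :=
  (CategoryTheory.Quotient.functor (MixedRel 𝓕 α D)).map (freeMap 𝓕 α f hf)

lemma mixedCategory_functor_ext {F G : MixedCategory 𝓕 α D ⥤ B}
    (h : extToMixed 𝓕 α D ⋙ F = extToMixed 𝓕 α D ⋙ G)
    (h' : ∀ {p q : RPair D} (f : C(X, X)) (hf : IsInessential 𝓕 D α f p q),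
      SameHom (F.map (mixedMap 𝓕 α f hf)) (G.map (mixedMap 𝓕 α f hf))) : F = G := by
  refine CategoryTheory.Quotient.lift_unique' _ _ _ (Paths.functor_ext_of_sameHom ?_ ?_)
  · rintro ⟨p⟩
    exact Functor.congr_obj h p
  · rintro ⟨p⟩ ⟨q⟩ (e | ⟨f, hf⟩)
    · exact SameHom.of_functor_eq h e
    · exact h' f hf

/-- The image of an inessential map in the pair component category is an identity. -/
lemma toComponentCategory_mixedMap {p q : RPair D} {f : C(X, X)}
    (hf : IsInessential 𝓕 D α f p q) :
    SameHom ((toComponentCategory (inessentialMorphisms 𝓕 α D)).map (mixedMap 𝓕 α f hf))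
      (𝟙 ((pairComponent 𝓕 α D).obj p)) :=
  toComponentCategory_map_sameHom _ (inessentialMorphisms.map f hf)

/-- Inessential maps are already identities in the source of the functors, so only the values on
extensions can differ. -/
lemma pairComponent_functor_ext {F G : PairComponentCategory 𝓕 α D ⥤ B}
    (h : pairComponent 𝓕 α D ⋙ F = pairComponent 𝓕 α D ⋙ G) : F = G := by
  refine componentCategory_functor_ext (mixedCategory_functor_ext h fun {p q} f hf => ?_)
  have h1 := (toComponentCategory_mixedMap hf).map F
  have h2 := (toComponentCategory_mixedMap hf).map G
  rw [CategoryTheory.Functor.map_id] at h1 h2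
  refine h1.trans (SameHom.trans ?_ h2.symm)
  have := SameHom.of_functor_eq h (𝟙 p)
  rwa [CategoryTheory.Functor.map_id, CategoryTheory.Functor.map_id] at this

/-- A commutative square in the mixed category with two sides inessential. -/
lemma pairComponent_sameHom_of_mixed {p q p' q' : RPair D} {f g : C(X, X)}
    {hf : IsInessential 𝓕 D α f p p'} {hg : IsInessential 𝓕 D α g q q'} {e : p ⟶ q} {e' : p' ⟶ q'}
    (h : mixedMap 𝓕 α f hf ≫ (extToMixed 𝓕 α D).map e' =
      (extToMixed 𝓕 α D).map e ≫ mixedMap 𝓕 α g hg) :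
    SameHom ((pairComponent 𝓕 α D).map e) ((pairComponent 𝓕 α D).map e') := by
  have := congrArg (toComponentCategory (inessentialMorphisms 𝓕 α D)).map h
  rw [Functor.map_comp, Functor.map_comp] at this
  refine ((SameHom.refl _).comp_id ?_).symm.trans ((SameHom.of_eq this.symm).trans
    ((SameHom.refl _).id_comp ?_))
  · exact toComponentCategory_mixedMap hg
  · exact (toComponentCategory_mixedMap hf).id_of_id

/-- Two morphisms of the mixed category that agree after precomposition with inessential maps. -/
lemma pairComponent_sameHom_of_span {p q r s : RPair D} {f g : C(X, X)}
    {hf : IsInessential 𝓕 D α f p q} {hg : IsInessential 𝓕 D α g p r} {e : q ⟶ s} {e' : r ⟶ s}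
    (h : mixedMap 𝓕 α f hf ≫ (extToMixed 𝓕 α D).map e =
      mixedMap 𝓕 α g hg ≫ (extToMixed 𝓕 α D).map e') :
    SameHom ((pairComponent 𝓕 α D).map e) ((pairComponent 𝓕 α D).map e') := by
  have := congrArg (toComponentCategory (inessentialMorphisms 𝓕 α D)).map h
  rw [Functor.map_comp, Functor.map_comp] at this
  refine ((SameHom.refl _).id_comp ?_).symm.trans ((SameHom.of_eq this).trans
    ((SameHom.refl _).id_comp ?_))
  · exact (toComponentCategory_mixedMap hf).id_of_id
  · exact (toComponentCategory_mixedMap hg).id_of_id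

/-- The two vertical sides of the naturality square collapse to identities, and the horizontal sides
become equal. -/
lemma pairComponent_square {p q : RPair D} (f : C(X, X)) (hd : IsDMap D D f)
    (hp : IsInessential 𝓕 D α f p (p.map f hd)) (hq : IsInessential 𝓕 D α f q (q.map f hd))
    (e : p ⟶ q) : SameHom ((pairComponent 𝓕 α D).map e)
      ((pairComponent 𝓕 α D).map ((extMap f hd).map e)) :=
  pairComponent_sameHom_of_mixed (hf := hp) (hg := hq)
    (CategoryTheory.Quotient.sound _ (MixedRel.square f hd hp hq e))

/-- After the maps `f` and `g` collapse, the flow relation trades motion of the target along a flow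
line for motion of the source. -/
lemma pairComponent_flow {p : RPair D} {f g : C(X, X)} {H : C(X × unitInterval, X)}
    (hH : IsSimpleDHomotopy D H) (h0 : ∀ x, H (x, 0) = f x) (h1 : ∀ x, H (x, 1) = g x)
    (hid : f = ContinuousMap.id X ∨ g = ContinuousMap.id X)
    (hfd : IsDMap D D f) (hgd : IsDMap D D g)
    (hf : IsInessential 𝓕 D α f p (p.map f hfd)) (hg : IsInessential 𝓕 D α g p (p.map g hgd))
    (hr : Nonempty (DPath D (f p.src) (g p.tgt))) :
    SameHom
      ((pairComponent 𝓕 α D).map (X := p.map f hfd) (Y := ⟨f p.src, g p.tgt, hr⟩)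
        (FundHom.refl (f p.src), FundHom.mk (flowPath H hH (h0 p.tgt) (h1 p.tgt))))
      ((pairComponent 𝓕 α D).map (X := p.map g hgd) (Y := ⟨f p.src, g p.tgt, hr⟩)
        (FundHom.mk (flowPath H hH (h0 p.src) (h1 p.src)), FundHom.refl (g p.tgt))) := by
  exact pairComponent_sameHom_of_span (hf := hf) (hg := hg)
    (CategoryTheory.Quotient.sound _ (MixedRel.flow f g H hH h0 h1 hid hfd hgd hf hg hr))

end PairLift

/-! ## The degree functor -/

namespace AngularShift

lemma shift_eq_iff (δ : AngularShift) (z w : Circle) :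
    z * Circle.exp (δ z) = w * Circle.exp (δ w) ↔ z = w := by
  refine ⟨fun h => ?_, fun h => by rw [h]⟩
  obtain ⟨ε, hε, -⟩ := δ.exists_inverse
  have hz := hε z
  rw [h, hε w] at hz
  rw [← neg_inj.1 hz] at h
  exact mul_right_cancel h

end AngularShift

lemma BitVec01.ext_bit {n : ℕ} {d d' : BitVec01 n} (h : ∀ i, d.bit i = d'.bit i) : d = d' := by
  cases d
  cases d'
  exact congrArg _ (funext h)

lemma BitVec01.hom_ext {n : ℕ} {d d' : BitVec01 n} {k l : d ⟶ d'} (h : ∀ i, k.1 i = l.1 i) :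
    k = l :=
  Subtype.ext (funext h)

lemma BitVec01.sameHom {n : ℕ} {a b a' b' : BitVec01 n} {k : a ⟶ b} {l : a' ⟶ b'} (ha : a = a')
    (hb : b = b') (h : ∀ i, k.1 i = l.1 i) : SameHom k l := by
  subst ha hb
  exact .of_eq (BitVec01.hom_ext h)

section Degree

variable {X : Type u} [TopologicalSpace X] {D : DStructure X} {n : ℕ} (c : TorusChart D n)

namespace TorusChart

/-- The least angular length of a d-path between the two points of a pair. -/
noncomputable def arc (p : RPair D) (i : Fin n) : ℝ :=
  Circle.angleDiff (c.coord p.src i) (c.coord p.tgt i)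

lemma arc_nonneg (p : RPair D) (i : Fin n) : 0 ≤ c.arc p i := Circle.angleDiff_nonneg _ _

lemma arc_lt (p : RPair D) (i : Fin n) : c.arc p i < 2 * Real.pi := Circle.angleDiff_lt_two_pi _ _

lemma arc_eq_zero (p : RPair D) (i : Fin n) (h : c.coord p.src i = c.coord p.tgt i) :
    c.arc p i = 0 := by
  rw [arc, h, Circle.angleDiff_self]

open Classical in
/-- The bit vector of a pair: the coordinates in which the two points differ. -/
noncomputable def bits (p : RPair D) : BitVec01 n :=
  ⟨fun i => decide (c.coord p.src i ≠ c.coord p.tgt i)⟩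

lemma bits_eq_true_iff (p : RPair D) (i : Fin n) :
    (c.bits p).bit i = true ↔ c.coord p.src i ≠ c.coord p.tgt i := by
  simp [bits]

lemma bits_eq_false_iff (p : RPair D) (i : Fin n) :
    (c.bits p).bit i = false ↔ c.coord p.src i = c.coord p.tgt i := by
  simp [bits]

/-- The prolonged arc and the arc of `q` lead from the same source to the same target, so they
differ by an integral number of turns. This number exceeds `-1`, since the prolonged arc is
non-negative and the arc of `q` is less than `2π`. -/
lemma exists_degree {p q : RPair D} (e : p ⟶ q) (i : Fin n) : ∃ k : ℕ,
    c.len e.1 i + c.arc p i + c.len e.2 i - c.arc q i = k * (2 * Real.pi) := by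
  have h1 := c.exp_len e.1 i
  have h2 := c.exp_len e.2 i
  have h3 : c.coord p.src i * Circle.exp (c.arc p i) = _ := Circle.mul_exp_angleDiff _ _
  have h4 : c.coord q.src i * Circle.exp (c.arc q i) = _ := Circle.mul_exp_angleDiff _ _
  have h5 : Circle.exp (c.len e.1 i + c.arc p i + c.len e.2 i) = Circle.exp (c.arc q i) := by
    rw [← mul_right_inj (c.coord q.src i), h4, Circle.exp_add, Circle.exp_add, ← mul_assoc,
      ← mul_assoc, ← h1, h3, ← h2]
  obtain ⟨m, hm⟩ := Circle.exp_eq_exp.1 h5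
  have hneg : (-1 : ℤ) < m := by
    have := c.len_nonneg e.1 i
    have := c.len_nonneg e.2 i
    have := c.arc_nonneg p i
    have := c.arc_lt q i
    have h : (-1 : ℝ) < m := by
      by_contra! h
      nlinarith [Real.two_pi_pos]
    exact_mod_cast h
  lift m to ℕ using by omega
  exact ⟨m, by rw [hm]; simp⟩

/-- The number of full turns added by an extension. -/
noncomputable def degree {p q : RPair D} (e : p ⟶ q) (i : Fin n) : ℕ := (c.exists_degree e i).choose

lemma degree_spec {p q : RPair D} (e : p ⟶ q) (i : Fin n) :
    c.len e.1 i + c.arc p i + c.len e.2 i - c.arc q i = c.degree e i * (2 * Real.pi) :=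
  (c.exists_degree e i).choose_spec

lemma degree_eq {p q : RPair D} (e : p ⟶ q) (i : Fin n) {k : ℕ}
    (h : c.len e.1 i + c.arc p i + c.len e.2 i - c.arc q i = k * (2 * Real.pi)) :
    c.degree e i = k := by
  have := mul_right_cancel₀ Real.two_pi_pos.ne' ((c.degree_spec e i).symm.trans h)
  exact_mod_cast this

/-- The arc is positive at the start and zero at the end, so at least one turn has to be completed.
This is the exceptional morphism set of the model category. -/
lemma degree_pos {p q : RPair D} (e : p ⟶ q) (i : Fin n) (hp : (c.bits p).bit i = true)
    (hq : (c.bits q).bit i = false) : 0 < c.degree e i := by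
  have h := c.degree_spec e i
  rw [c.arc_eq_zero q i ((c.bits_eq_false_iff q i).1 hq)] at h
  have := c.len_nonneg e.1 i
  have := c.len_nonneg e.2 i
  have : 0 < c.arc p i := Circle.angleDiff_pos ((c.bits_eq_true_iff p i).1 hp)
  rw [Nat.pos_iff_ne_zero]
  intro h0
  rw [h0] at h
  simp at h
  linarith

/-- The functor that counts full turns. -/
noncomputable def degreeFunctor : RPair D ⥤ BitVec01 n where
  obj p := c.bits p
  map e := ⟨c.degree e, c.degree_pos e⟩
  map_id p := BitVec01.hom_ext fun i => c.degree_eq (𝟙 p) i (by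
    change c.len (FundHom.refl p.src) i + _ + c.len (FundHom.refl p.tgt) i - _ = ((0 : ℕ) : ℝ) * _
    simp)
  map_comp {p q r} e e' := BitVec01.hom_ext fun i => c.degree_eq (e ≫ e') i (by
    change c.len (e'.1.trans e.1) i + _ + c.len (e.2.trans e'.2) i - _ =
      ((c.degree e i + c.degree e' i : ℕ) : ℝ) * _
    have h1 := c.degree_spec e i
    have h2 := c.degree_spec e' i
    rw [len_trans, len_trans]
    push_cast
    linarith)

lemma bits_eq_of_isInessential {𝓕 : EquivalenceFamily.{u}} {α : Flavour} {f : C(X, X)}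
    {p q : RPair D} (hf : IsInessential 𝓕 D α f p q) : c.bits p = c.bits q := by
  obtain ⟨δ, rfl⟩ := c.exists_shift_of_isInessential 𝓕 hf
  refine BitVec01.ext_bit fun i => ?_
  rw [Bool.eq_iff_iff, bits_eq_true_iff, bits_eq_true_iff, ← hf.1, ← hf.2.1, coord_shiftMap,
    coord_shiftMap, Ne, Ne, (δ i).shift_eq_iff]

lemma arc_map_shiftMap (δ : Fin n → AngularShift) (hd : IsDMap D D (c.shiftMap δ)) (p : RPair D)
    (i : Fin n) : c.arc (p.map _ hd) i =
      c.arc p i + δ i (c.coord p.tgt i) - δ i (c.coord p.src i) := by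
  change Circle.angleDiff (c.coord (c.shiftMap δ p.src) i) (c.coord (c.shiftMap δ p.tgt) i) = _
  rw [coord_shiftMap, coord_shiftMap, AngularShift.angleDiff_shift]
  rfl

lemma len_map_shiftMap (δ : Fin n → AngularShift) (hd : IsDMap D D (c.shiftMap δ)) {x y : X}
    (σ : FundHom D x y) (i : Fin n) : c.len (FundHom.map _ hd rfl rfl σ) i =
      c.len σ i + δ i (c.coord y i) - δ i (c.coord x i) :=
  c.len_map c _ hd rfl rfl i i (fun x => δ i (c.coord x i)) (by fun_prop)
    (fun x => c.coord_shiftMap δ x i) σ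

/-- Lengths and arcs change by differences of `δ` at the ends, and these telescope. -/
lemma degree_map_shiftMap (δ : Fin n → AngularShift) (hd : IsDMap D D (c.shiftMap δ))
    {p q : RPair D} (e : p ⟶ q) (i : Fin n) :
    c.degree ((extMap _ hd).map e) i = c.degree e i := by
  refine c.degree_eq _ i ?_
  change c.len (FundHom.map _ hd rfl rfl e.1) i + c.arc (p.map _ hd) i +
    c.len (FundHom.map _ hd rfl rfl e.2) i - c.arc (q.map _ hd) i = _
  rw [len_map_shiftMap, len_map_shiftMap, arc_map_shiftMap, arc_map_shiftMap,
    ← c.degree_spec e i]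
  ring

/-- The lengths of the flow lines of a simple d-homotopy between two shifts. -/
lemma len_flowPath_sub {H : C(X × unitInterval, X)} (hH : IsSimpleDHomotopy D H)
    {δ ε : Fin n → AngularShift} (h0 : ∀ x, H (x, 0) = c.shiftMap δ x)
    (h1 : ∀ x, H (x, 1) = c.shiftMap ε x) (p : RPair D) (i : Fin n) :
    c.pathLen (flowPath H hH (h0 p.tgt) (h1 p.tgt)) i + δ i (c.coord p.tgt i) -
        ε i (c.coord p.tgt i) =
      c.pathLen (flowPath H hH (h0 p.src) (h1 p.src)) i + δ i (c.coord p.src i) -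
        ε i (c.coord p.src i) := by
  obtain ⟨Θ, hΘ, hH', hΘ0⟩ := Circle.exists_lift_homotopy
    (fun q : X × unitInterval => c.coord (H q) i / c.coord q.1 i) (by fun_prop)
    (fun x => δ i (c.coord x i)) (by fun_prop) fun x => by
      simp only [h0, coord_shiftMap, mul_div_cancel_left]
  have hlen : ∀ x, c.pathLen (flowPath H hH (h0 x) (h1 x)) i = Θ (x, 1) - Θ (x, 0) := fun x => by
    rw [c.pathLen_eq _ i (g := fun t => Complex.arg (c.coord x i) + Θ (x, t)) (by fun_prop)]
    · ring
    · intro t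
      rw [Circle.exp_add, Circle.exp_arg, ← hH', mul_div_cancel]
      rfl
  obtain ⟨γ⟩ := p.reachable
  -- The lifted displacement at time `1` and the angle `ε` differ by a multiple of `2π`. The
  -- multiple is constant along a d-path from the source to the target, which is where reachability
  -- of the pair enters.
  have := Circle.const_of_exp_const (f := fun t => Θ (γ.1 t, 1) - ε i (c.coord (γ.1 t) i))
    (by fun_prop) (z := 1) (fun t => by
      rw [Circle.exp_sub, ← hH', h1, coord_shiftMap, mul_div_cancel_left, div_self']) 0 1
  simp only [γ.1.source, γ.1.target] at this
  rw [hlen, hlen, hΘ0, hΘ0]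
  linarith

variable (𝓕 : EquivalenceFamily.{u}) (α : Flavour)

/-- The degree on the generators of the mixed category. -/
noncomputable def mixedDegreePrefunctor : MixedVertex 𝓕 α D ⥤q BitVec01 n where
  obj v := c.bits v.pair
  map {v w} (g : MixedGen 𝓕 α v.pair w.pair) := match g with
    | .ext e => c.degreeFunctor.map e
    | .map _ hf => ⟨0, fun i h h' => by
        rw [c.bits_eq_of_isInessential hf, h'] at h
        cases h⟩

lemma lift_freeExt {p q : RPair D} (e : p ⟶ q) :
    (Paths.lift (c.mixedDegreePrefunctor 𝓕 α)).map (freeExt 𝓕 α e) = c.degreeFunctor.map e :=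
  Paths.lift_map_of _ _

lemma lift_freeMap {p q : RPair D} (f : C(X, X)) (hf : IsInessential 𝓕 D α f p q) (i : Fin n) :
    ((Paths.lift (c.mixedDegreePrefunctor 𝓕 α)).map (freeMap 𝓕 α f hf)).1 i = 0 :=
  congrArg (fun k => k.1 i) (Paths.lift_map_of (c.mixedDegreePrefunctor 𝓕 α)
    (x := ⟨p⟩) (y := ⟨q⟩) (MixedGen.map f hf))

lemma _root_.BitVec01.comp_apply {d d' d'' : BitVec01 n} (k : d ⟶ d') (l : d' ⟶ d'') (i : Fin n) :
    (k ≫ l).1 i = k.1 i + l.1 i := rfl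

/-- The degree functor on the mixed category. -/
noncomputable def mixedDegree : MixedCategory 𝓕 α D ⥤ BitVec01 n :=
  CategoryTheory.Quotient.lift _ (Paths.lift (c.mixedDegreePrefunctor 𝓕 α)) (by
    intro _ _ _ _ h
    cases h with
    | ext_id p =>
      rw [lift_freeExt, CategoryTheory.Functor.map_id, CategoryTheory.Functor.map_id]
      rfl
    | ext_comp e e' =>
      rw [Functor.map_comp, lift_freeExt, lift_freeExt, lift_freeExt, Functor.map_comp]
      rfl
    | map_id h =>
      refine BitVec01.hom_ext fun i => ?_
      rw [lift_freeMap, CategoryTheory.Functor.map_id]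
      rfl
    | map_comp f g hf hg hgf =>
      refine BitVec01.hom_ext fun i => ?_
      rw [Functor.map_comp, BitVec01.comp_apply, lift_freeMap, lift_freeMap, lift_freeMap]
    | square f hd hp hq e =>
      refine BitVec01.hom_ext fun i => ?_
      rw [Functor.map_comp, Functor.map_comp]
      refine (congrArg₂ (· + ·) (c.lift_freeMap 𝓕 α f hp i) (congrArg (fun k => k.1 i)
        (c.lift_freeExt 𝓕 α ((extMap f hd).map e)))).trans (Eq.trans ?_ (congrArg₂ (· + ·)
        (congrArg (fun k => k.1 i) (c.lift_freeExt 𝓕 α e)) (c.lift_freeMap 𝓕 α f hq i)).symm)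
      obtain ⟨δ, rfl⟩ := c.exists_shift_of_isInessential 𝓕 hp
      exact (zero_add _).trans ((c.degree_map_shiftMap δ hd e i).trans (add_zero _).symm)
    | @flow p f g H hH h0 h1 hid hfd hgd hf hg hr =>
      refine BitVec01.hom_ext fun i => ?_
      rw [Functor.map_comp, Functor.map_comp, BitVec01.comp_apply, BitVec01.comp_apply,
        lift_freeMap, lift_freeMap, lift_freeExt, lift_freeExt, zero_add, zero_add]
      obtain ⟨δ, rfl⟩ := c.exists_shift_of_isInessential 𝓕 hf
      obtain ⟨ε, rfl⟩ := c.exists_shift_of_isInessential 𝓕 hg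
      refine c.degree_eq _ i ((Eq.trans ?_ (c.degree_spec (p := p.map _ hgd)
        (q := ⟨c.shiftMap δ p.src, c.shiftMap ε p.tgt, hr⟩)
        (FundHom.mk (flowPath H hH (h0 p.src) (h1 p.src)), FundHom.refl (c.shiftMap ε p.tgt)) i)))
      have := c.len_flowPath_sub hH h0 h1 p i
      change c.len (FundHom.refl (c.shiftMap δ p.src)) i + c.arc (p.map _ hfd) i +
        c.pathLen (flowPath H hH (h0 p.tgt) (h1 p.tgt)) i - _ =
        c.pathLen (flowPath H hH (h0 p.src) (h1 p.src)) i + c.arc (p.map _ hgd) i +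
        c.len (FundHom.refl (c.shiftMap ε p.tgt)) i - _
      rw [len_refl, len_refl, arc_map_shiftMap, arc_map_shiftMap]
      linarith)

lemma mixedDegree_map {p q : RPair D} (f : C(X, X)) (hf : IsInessential 𝓕 D α f p q) :
    SameHom ((c.mixedDegree 𝓕 α).map (mixedMap 𝓕 α f hf)) (𝟙 (c.bits p)) :=
  BitVec01.sameHom rfl (c.bits_eq_of_isInessential hf).symm (c.lift_freeMap 𝓕 α f hf)

/-- The degree functor on the pair component category. -/
noncomputable def componentDegree : PairComponentCategory 𝓕 α D ⥤ BitVec01 n :=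
  componentLift (c.mixedDegree 𝓕 α) (by
    rintro _ _ _ ⟨f, hf⟩
    exact c.mixedDegree_map 𝓕 α f hf)

lemma pairComponent_comp_componentDegree :
    pairComponent 𝓕 α D ⋙ c.componentDegree 𝓕 α = c.degreeFunctor := by
  refine CategoryTheory.Functor.hext (fun p => rfl) fun p q e => ?_
  have h := SameHom.of_functor_eq (toComponentCategory_comp_componentLift
    (W := inessentialMorphisms 𝓕 α D) (c.mixedDegree 𝓕 α) (by
    rintro _ _ _ ⟨f, hf⟩
    exact c.mixedDegree_map 𝓕 α f hf)) ((extToMixed 𝓕 α D).map e)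
  exact (h.trans (.of_eq (c.lift_freeExt 𝓕 α e))).heq

end TorusChart

end Degree

/-! ## Shifts with prescribed values -/

namespace AngularShift

/-- The map `t ↦ ⌊t⌋ + fract(t) ^ γ`. -/
lemma exists_floor_add_fract_rpow {γ : ℝ} (h0 : 0 < γ) :
    ∃ ψ : ℝ ≃o ℝ, ∀ t, ψ t = ⌊t⌋ + Int.fract t ^ γ := by
  have hlt : ∀ (t : ℝ) {ρ : ℝ}, 0 < ρ → Int.fract t ^ ρ < 1 := fun t ρ hρ =>
    Real.rpow_lt_one (Int.fract_nonneg t) (Int.fract_lt_one t) hρ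
  have hnn : ∀ (t ρ : ℝ), 0 ≤ Int.fract t ^ ρ := fun t ρ =>
    Real.rpow_nonneg (Int.fract_nonneg t) ρ
  have hm : StrictMono fun t : ℝ => (⌊t⌋ : ℝ) + Int.fract t ^ γ := fun s t hst => by
    rcases (Int.floor_mono hst.le).eq_or_lt with h | h
    · have : Int.fract s < Int.fract t := by
        rw [Int.fract, Int.fract, h]
        linarith
      simpa only [h, add_lt_add_iff_left] using Real.rpow_lt_rpow (Int.fract_nonneg s) this h0
    · have h' : (⌊s⌋ : ℝ) + 1 ≤ ⌊t⌋ := by exact_mod_cast h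
      have := hlt s h0
      have := hnn t γ
      simp only
      linarith
  have hs : Function.Surjective fun t : ℝ => (⌊t⌋ : ℝ) + Int.fract t ^ γ := fun s => by
    have hf : ⌊(⌊s⌋ : ℝ) + Int.fract s ^ γ⁻¹⌋ = ⌊s⌋ := by
      rw [Int.floor_eq_iff]
      exact ⟨le_add_of_nonneg_right (hnn s _), add_lt_add_right (hlt s (inv_pos.2 h0)) _⟩
    refine ⟨⌊s⌋ + Int.fract s ^ γ⁻¹, ?_⟩
    simp only
    rw [hf, Int.fract, hf, add_sub_cancel_left, Real.rpow_inv_rpow (Int.fract_nonneg s) h0.ne',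
      Int.floor_add_fract]
  exact ⟨hm.orderIsoOfSurjective _ hs, fun t => rfl⟩

/-- A non-negative shift that fixes `1` and moves a given point to a given later point. -/
lemma exists_shift_apply {u v : ℝ} (h0 : 0 < u) (huv : u ≤ v) (hv : v < 2 * Real.pi) :
    ∃ δ : AngularShift, (∀ z, 0 ≤ δ z) ∧ δ 1 = 0 ∧ δ (Circle.exp u) = v - u := by
  have hπ := Real.two_pi_pos
  have ha0 : 0 < u / (2 * Real.pi) := div_pos h0 hπ
  have hab : u / (2 * Real.pi) ≤ v / (2 * Real.pi) := by gcongr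
  have hb1 : v / (2 * Real.pi) < 1 := (div_lt_one hπ).2 hv
  set a := u / (2 * Real.pi)
  set b := v / (2 * Real.pi)
  have hla : Real.log a < 0 := Real.log_neg ha0 (hab.trans_lt hb1)
  have hlb : Real.log b < 0 := Real.log_neg (ha0.trans_le hab) hb1
  -- In units of full turns, `t ↦ ⌊t⌋ + fract(t) ^ γ` fixes the integers. The exponent `log b / log
  -- a` is chosen so that `a ^ γ = b`; as `a ≤ b < 1` it lies in `(0, 1]`, hence no point moves
  -- backwards.
  have hγ0 : 0 < Real.log b / Real.log a := div_pos_of_neg_of_neg hlb hla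
  have hγ1 : Real.log b / Real.log a ≤ 1 := (div_le_one_of_neg hla).2 (Real.log_le_log ha0 hab)
  have hγ : a ^ (Real.log b / Real.log a) = b := by
    rw [Real.rpow_def_of_pos ha0, mul_div_cancel₀ _ hla.ne, Real.exp_log (ha0.trans_le hab)]
  obtain ⟨ψ, hψ⟩ := exists_floor_add_fract_rpow hγ0
  have hper : ∀ t, ψ (t + 1) = ψ t + 1 := fun t => by
    rw [hψ, hψ, Int.floor_add_one, Int.fract_add_one]
    push_cast
    ring
  have hle : ∀ t, t ≤ ψ t := fun t => by
    have := Real.rpow_le_rpow_of_exponent_ge' (Int.fract_nonneg t) (Int.fract_lt_one t).le hγ0.le hγ1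
    rw [Real.rpow_one] at this
    rw [hψ]
    linarith [Int.floor_add_fract t]
  have hψc : Continuous ψ := ψ.continuous
  obtain ⟨δ, hδ⟩ := Circle.exists_of_periodic
    (fun s => 2 * Real.pi * ψ (s / (2 * Real.pi)) - s) (by fun_prop) (fun s => by
      simp only [add_div, div_self hπ.ne', hper]
      ring)
  refine ⟨⟨δ, ?_⟩, fun z => ?_, ?_, ?_⟩
  · intro s t hst
    simp only [hδ, add_sub_cancel]
    gcongr
  · obtain ⟨s, rfl⟩ := Circle.exp_surjective z
    change 0 ≤ δ _
    rw [hδ, sub_nonneg]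
    calc s = 2 * Real.pi * (s / (2 * Real.pi)) := by field_simp
      _ ≤ _ := by gcongr; exact hle _
  · change δ 1 = 0
    rw [← Circle.exp_zero, hδ, zero_div, hψ]
    simp [Real.zero_rpow hγ0.ne']
  · change δ _ = _
    have hfl : ⌊a⌋ = 0 := Int.floor_eq_zero_iff.2 ⟨ha0.le, hab.trans_lt hb1⟩
    rw [hδ, hψ, hfl, Int.fract_eq_self.2 ⟨ha0.le, hab.trans_lt hb1⟩, hγ, Int.cast_zero, zero_add]
    congr 1
    simp only [b]
    field_simp

end AngularShift

/-! ## Normal forms in the pair component category -/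

section NormalForm

variable {X : Type u} [TopologicalSpace X] {D : DStructure X} {n : ℕ} (c : TorusChart D n)

namespace TorusChart

lemma sameHom_of_len {p q p' q' : RPair D} {e : p ⟶ q} {e' : p' ⟶ q'} (hp : p = p') (hq : q = q')
    (h1 : ∀ i, c.len e.1 i = c.len e'.1 i) (h2 : ∀ i, c.len e.2 i = c.len e'.2 i) :
    SameHom e e' := by
  subst hp hq
  exact .of_eq (Prod.ext (c.hom_ext h1) (c.hom_ext h2))

/-- An extension with given angular lengths. -/
lemma exists_ext {p q : RPair D} (L M : Fin n → ℝ) (hL : ∀ i, 0 ≤ L i) (hM : ∀ i, 0 ≤ M i)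
    (h1 : ∀ i, c.coord p.src i = c.coord q.src i * Circle.exp (L i))
    (h2 : ∀ i, c.coord q.tgt i = c.coord p.tgt i * Circle.exp (M i)) :
    ∃ e : p ⟶ q, (∀ i, c.len e.1 i = L i) ∧ ∀ i, c.len e.2 i = M i := by
  obtain ⟨σ, hσ⟩ := c.exists_len_eq L hL h1
  obtain ⟨τ, hτ⟩ := c.exists_len_eq M hM h2
  exact ⟨(σ, τ), hσ, hτ⟩

lemma len_comp_fst {p q r : RPair D} (e : p ⟶ q) (e' : q ⟶ r) (i : Fin n) :
    c.len (e ≫ e').1 i = c.len e'.1 i + c.len e.1 i := c.len_trans _ _ i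

lemma len_comp_snd {p q r : RPair D} (e : p ⟶ q) (e' : q ⟶ r) (i : Fin n) :
    c.len (e ≫ e').2 i = c.len e.2 i + c.len e'.2 i := c.len_trans _ _ i

lemma len_id_fst (p : RPair D) (i : Fin n) : c.len (𝟙 p : p ⟶ p).1 i = 0 := c.len_refl _ i

lemma len_id_snd (p : RPair D) (i : Fin n) : c.len (𝟙 p : p ⟶ p).2 i = 0 := c.len_refl _ i

/-- The pair of two points. -/
def pair (x y : X) : RPair D := ⟨x, y, c.nonempty_dpath x y⟩

variable (𝓕 : EquivalenceFamily.{u}) (α : Flavour)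

lemma shiftMap_const_zero : c.shiftMap (fun _ => .const 0) = ContinuousMap.id X := by
  ext x
  exact c.coord_ext fun i => by simp

lemma isInessential_id (c : TorusChart D n) {p q : RPair D} (hs : p.src = q.src) (ht : p.tgt = q.tgt) :
    IsInessential 𝓕 D α (ContinuousMap.id X) p q := by
  rw [← c.shiftMap_const_zero]
  refine c.isInessential_shiftMap 𝓕 (fun _ _ _ => le_rfl) (fun _ _ _ => le_rfl) ?_ ?_ <;>
    rw [shiftMap_const_zero] <;> assumption

/-- Rotations act trivially. -/
lemma sameHom_of_rotation (a : Fin n → ℝ) {p q p' q' : RPair D} {e : p ⟶ q} {e' : p' ⟶ q'}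
    (hps : ∀ i, c.coord p'.src i = c.coord p.src i * Circle.exp (a i))
    (hpt : ∀ i, c.coord p'.tgt i = c.coord p.tgt i * Circle.exp (a i))
    (hqs : ∀ i, c.coord q'.src i = c.coord q.src i * Circle.exp (a i))
    (hqt : ∀ i, c.coord q'.tgt i = c.coord q.tgt i * Circle.exp (a i))
    (h1 : ∀ i, c.len e.1 i = c.len e'.1 i) (h2 : ∀ i, c.len e.2 i = c.len e'.2 i) :
    SameHom ((pairComponent 𝓕 α D).map e) ((pairComponent 𝓕 α D).map e') := by
  -- Only the rotation matters, not its angle. A representative is taken in `[0, 2π)`, or in `[-2π,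
  -- 0)` for the past flavour, to have the sign that makes the rotation inessential.
  obtain ⟨b, hb, hpos, hneg⟩ : ∃ b : Fin n → ℝ, (∀ i, Circle.exp (b i) = Circle.exp (a i)) ∧
      (α ≠ .past → ∀ i, 0 ≤ b i) ∧ (α = .past → ∀ i, b i ≤ 0) := by
    have h : ∀ i, Circle.exp (Circle.angleDiff 1 (Circle.exp (a i))) = Circle.exp (a i) :=
      fun i => by simpa using Circle.mul_exp_angleDiff 1 (Circle.exp (a i))
    by_cases hα : α = .past
    · refine ⟨fun i => Circle.angleDiff 1 (Circle.exp (a i)) - 2 * Real.pi, fun i => ?_,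
        fun h => absurd hα h, fun _ i => ?_⟩
      · rw [Circle.exp_sub_two_pi, h]
      · exact sub_nonpos.2 (Circle.angleDiff_lt_two_pi _ _).le
    · exact ⟨_, h, fun _ i => Circle.angleDiff_nonneg _ _, fun h => absurd h hα⟩
  let δ : Fin n → AngularShift := fun i => .const (b i)
  have hd := c.isDMap_shiftMap δ
  have hin : ∀ r, IsInessential 𝓕 D α (c.shiftMap δ) r (r.map _ hd) := fun r =>
    c.isInessential_shiftMap 𝓕 (fun h i _ => hpos h i) (fun h i _ => hneg h i) rfl rfl
  refine (pairComponent_square _ hd (hin p) (hin q) e).trans (SameHom.map _ ?_)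
  refine c.sameHom_of_len ?_ ?_ (fun i => ?_) (fun i => ?_)
  · exact RPair.ext (c.coord_ext fun i => (c.coord_shiftMap δ _ i).trans (by simp [δ, hb, hps]))
      (c.coord_ext fun i => (c.coord_shiftMap δ _ i).trans (by simp [δ, hb, hpt]))
  · exact RPair.ext (c.coord_ext fun i => (c.coord_shiftMap δ _ i).trans (by simp [δ, hb, hqs]))
      (c.coord_ext fun i => (c.coord_shiftMap δ _ i).trans (by simp [δ, hb, hqt]))
  · refine (c.len_map_shiftMap δ hd e.1 i).trans ?_
    simp [δ, h1]
  · refine (c.len_map_shiftMap δ hd e.2 i).trans ?_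
    simp [δ, h2]

lemma pathLen_flowPath {H : C(X × unitInterval, X)} (hH : IsSimpleDHomotopy D H)
    {δ : Fin n → AngularShift} {a : C(unitInterval, unitInterval)}
    (h : H = c.shiftFlow δ a) {x y z : X} (hy : H (x, 0) = y) (hz : H (x, 1) = z) (i : Fin n) :
    c.pathLen (flowPath H hH hy hz) i = (a 1 - a 0 : ℝ) * δ i (c.coord x i) := by
  subst h
  rw [c.pathLen_eq _ i (g := fun t => Complex.arg (c.coord x i) + a t * δ i (c.coord x i))
    (by fun_prop)]
  · ring
  · intro t
    rw [Circle.exp_add, Circle.exp_arg]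
    exact c.coord_shiftFlow δ a (x, t) i

/-- Flow lines at the target may be replaced by flow lines at the source. -/
lemma sameHom_of_flow {δ : Fin n → AngularShift} (hδ : ∀ i z, 0 ≤ δ i z) {p p' q : RPair D}
    {e : p ⟶ q} {e' : p' ⟶ q} (hs : c.shiftMap δ p.src = p'.src) (ht : c.shiftMap δ p.tgt = p'.tgt)
    (hps : p.src = q.src) (hpt : p'.tgt = q.tgt)
    (h1 : ∀ i, c.len e.1 i = 0) (h2 : ∀ i, c.len e.2 i = δ i (c.coord p.tgt i))
    (h3 : ∀ i, c.len e'.1 i = δ i (c.coord p.src i)) (h4 : ∀ i, c.len e'.2 i = 0) :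
    SameHom ((pairComponent 𝓕 α D).map e) ((pairComponent 𝓕 α D).map e') := by
  have hd := c.isDMap_shiftMap δ
  have hid : IsDMap D D (ContinuousMap.id X) := fun γ hγ => hγ
  -- For the past flavour `δ` itself need not be inessential. There the flow from the inverse shift
  -- to the identity is applied at `p'`; it has the same flow lines.
  by_cases hα : α = .past
  · choose ε hε hε' using fun i => (δ i).exists_inverse
    have hε0 : ∀ i z, ε i z ≤ 0 := fun i z => by
      have := hδ i (z * Circle.exp (ε i z))
      rw [hε'] at this
      linarith
    have hinv : ∀ x, c.shiftMap ε (c.shiftMap δ x) = x := fun x =>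
      congrArg (fun k => k x) (c.shiftMap_comp_eq_id hε)
    have hs' : c.shiftMap ε p'.src = p.src := by rw [← hs, hinv]
    have ht' : c.shiftMap ε p'.tgt = p.tgt := by rw [← ht, hinv]
    have hd' := c.isDMap_shiftMap ε
    have hH := c.isSimpleDHomotopy_of_nonpos hε0
    have key := pairComponent_flow (𝓕 := 𝓕) (α := α) (p := p') hH
      (f := c.shiftMap ε) (g := ContinuousMap.id X)
      (fun x => congrArg (fun k => k x) (c.level_shiftFlow_of_eq_one ε _ (t := 0) (by simp)))
      (fun x => congrArg (fun k => k x) (c.level_shiftFlow_of_eq_zero ε _ (t := 1) (by simp)))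
      (.inr rfl) hd' hid
      (c.isInessential_shiftMap 𝓕 (fun h => absurd hα h) (fun _ => hε0) rfl rfl)
      (isInessential_id 𝓕 α c rfl rfl) (c.nonempty_dpath _ _)
    have hq : q = ⟨c.shiftMap ε p'.src, p'.tgt, c.nonempty_dpath _ _⟩ :=
      RPair.ext (hps.symm.trans hs'.symm) hpt.symm
    refine (SameHom.map _ ?_).trans (key.trans (SameHom.map _ ?_))
    · refine c.sameHom_of_len (RPair.ext hs'.symm ht'.symm) hq (fun i => ?_) (fun i => ?_)
      · exact (h1 i).trans (c.len_refl _ i).symm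
      · refine (h2 i).trans (Eq.trans ?_ (c.pathLen_flowPath hH (δ := ε) rfl _ _ i).symm)
        rw [← ht, coord_shiftMap, hε]
        simp
    · refine c.sameHom_of_len (RPair.ext rfl rfl) hq.symm (fun i => ?_) (fun i => ?_)
      · refine (c.pathLen_flowPath hH (δ := ε) rfl _ _ i).trans (Eq.trans ?_ (h3 i).symm)
        rw [← hs, coord_shiftMap, hε]
        simp
      · exact (c.len_refl _ i).trans (h4 i).symm
  · have hH := c.isSimpleDHomotopy_of_nonneg hδ
    have key := pairComponent_flow (𝓕 := 𝓕) (α := α) (p := p) hH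
      (f := ContinuousMap.id X) (g := c.shiftMap δ)
      (fun x => congrArg (fun k => k x) (c.level_shiftFlow_of_eq_zero δ _ (t := 0) (by simp)))
      (fun x => congrArg (fun k => k x) (c.level_shiftFlow_of_eq_one δ _ (t := 1) (by simp)))
      (.inl rfl) hid hd (isInessential_id 𝓕 α c rfl rfl)
      (c.isInessential_shiftMap 𝓕 (fun _ => hδ) (fun h => absurd h hα) rfl rfl)
      (c.nonempty_dpath _ _)
    have hq : q = ⟨p.src, c.shiftMap δ p.tgt, c.nonempty_dpath _ _⟩ :=
      RPair.ext hps.symm (hpt.symm.trans ht.symm)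
    refine (SameHom.map _ ?_).trans (key.trans (SameHom.map _ ?_))
    · refine c.sameHom_of_len (RPair.ext rfl rfl) hq (fun i => ?_) (fun i => ?_)
      · exact (h1 i).trans (c.len_refl _ i).symm
      · refine (h2 i).trans (Eq.trans ?_ (c.pathLen_flowPath hH (δ := δ) rfl _ _ i).symm)
        simp
    · refine c.sameHom_of_len (RPair.ext hs ht) hq.symm (fun i => ?_) (fun i => ?_)
      · refine (c.pathLen_flowPath hH (δ := δ) rfl _ _ i).trans (Eq.trans ?_ (h3 i).symm)
        simp
      · exact (c.len_refl _ i).trans (h4 i).symm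

/-- The pairs with source `1`. -/
noncomputable def basedPair (u : Fin n → ℝ) : RPair D := c.pair (c.point 0) (c.point u)

/-- Moving the target without meeting the source is trivial. -/
lemma sameHom_id_of_move {u v : Fin n → ℝ}
    (h : ∀ i, (u i = 0 ∧ v i = 0) ∨ (0 < u i ∧ u i ≤ v i ∧ v i < 2 * Real.pi))
    {e : c.basedPair u ⟶ c.basedPair v} (h1 : ∀ i, c.len e.1 i = 0)
    (h2 : ∀ i, c.len e.2 i = v i - u i) :
    SameHom ((pairComponent 𝓕 α D).map e) (𝟙 ((pairComponent 𝓕 α D).obj (c.basedPair u))) := by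
  -- The shift fixes the source `1`, so its flow line there is constant. The flow relation then
  -- compares the motion of the target with an identity.
  have : ∀ i, ∃ δ : AngularShift, (∀ z, 0 ≤ δ z) ∧ δ 1 = 0 ∧
      δ (Circle.exp (u i)) = v i - u i := fun i => by
    rcases h i with ⟨hu, hv⟩ | ⟨h0, huv, hv⟩
    · exact ⟨.const 0, fun z => le_rfl, rfl, by simp [hu, hv]⟩
    · exact AngularShift.exists_shift_apply h0 huv hv
  choose δ hδ hδ1 hδu using this
  have hp0 : c.shiftMap δ (c.point 0) = c.point 0 := c.coord_ext fun i => by simp [hδ1]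
  have hpu : c.shiftMap δ (c.point u) = c.point v := c.coord_ext fun i => by
    simp [hδu]
  have key := c.sameHom_of_flow 𝓕 α hδ (e := e) (e' := 𝟙 (c.basedPair v)) hp0 hpu rfl rfl h1
    (fun i => (h2 i).trans (by
      change _ = δ i (c.coord (c.point u) i)
      rw [coord_point, hδu]))
    (fun i => (c.len_id_fst _ i).trans (by
      change _ = δ i (c.coord (c.point 0) i)
      simp [hδ1])) (c.len_id_snd _)
  rw [CategoryTheory.Functor.map_id] at key
  exact key.src_id_of_id

end TorusChart

end NormalForm

/-! ### The standard extensions and the inverse of the degree functor. -/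

section Section

lemma Circle.exp_angleDiff (z w : Circle) : Circle.exp (Circle.angleDiff z w) = w / z := by
  rw [eq_div_iff_mul_eq', Circle.exp_angleDiff_mul]

variable {X : Type u} [TopologicalSpace X] {D : DStructure X} {n : ℕ} (c : TorusChart D n)
  (𝓕 : EquivalenceFamily.{u}) (α : Flavour)

namespace TorusChart

/-- Every extension may be replaced by one that fixes the source `1`. -/
lemma exists_based_sameHom {p q : RPair D} (e : p ⟶ q) : ∃ (u v : Fin n → ℝ)
    (e' : c.basedPair u ⟶ c.basedPair v), (∀ i, 0 ≤ u i ∧ u i < 2 * Real.pi) ∧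
      (∀ i, 0 ≤ v i ∧ v i < 2 * Real.pi) ∧ (∀ i, c.len e'.1 i = 0) ∧
      SameHom ((pairComponent 𝓕 α D).map e) ((pairComponent 𝓕 α D).map e') := by
  have hs := c.exp_len e.1
  have ht := c.exp_len e.2
  have ha := c.len_nonneg e.1
  have hb := c.len_nonneg e.2
  set a := c.len e.1
  set b := c.len e.2
  -- The extension is split as `e₁ ≫ e₂`, target first and source second. Rotation by `-a` turns
  -- `e₁` into `e₃`, and the flow of the rotation by `a` turns the source motion `e₂` into the
  -- target motion `e₄`. Then `e₃ ≫ e₄` keeps the source `q.src` fixed.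
  let r : X → X := c.shiftMap fun i => .const (-a i)
  have hr : ∀ x i, c.coord (r x) i = c.coord x i * Circle.exp (-a i) := fun x i =>
    c.coord_shiftMap _ x i
  have hz : ∀ i : Fin n, (0 : ℝ) ≤ (0 : Fin n → ℝ) i := fun _ => le_rfl
  obtain ⟨e₁, h₁, h₁'⟩ := c.exists_ext (p := p) (q := c.pair p.src q.tgt) 0 b hz hb
    (fun i => by simp [pair]) ht
  obtain ⟨e₂, h₂, h₂'⟩ := c.exists_ext (p := c.pair p.src q.tgt) (q := q) a 0 ha hz
    hs (fun i => by simp [pair])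
  obtain ⟨e₃, h₃, h₃'⟩ := c.exists_ext (p := c.pair q.src (r p.tgt)) (q := c.pair q.src (r q.tgt))
    0 b hz hb (fun i => by simp [pair]) (fun i => by simp only [pair, hr, ht]; exact mul_right_comm _ _ _)
  obtain ⟨e₄, h₄, h₄'⟩ := c.exists_ext (p := c.pair q.src (r q.tgt)) (q := q)
    0 a hz ha (fun i => by simp [pair]) (fun i => by simp [pair, hr])
  have he : e = e₁ ≫ e₂ := (c.sameHom_of_len rfl rfl
    (fun i => by rw [len_comp_fst, h₁, h₂]; simp [a])
    (fun i => by rw [len_comp_snd, h₁', h₂']; simp [b])).eq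
  have h13 := c.sameHom_of_rotation 𝓕 α (fun i => -a i) (e := e₁) (e' := e₃)
    (fun i => by simp [pair, hs]) (fun i => by simp [pair, hr])
    (fun i => by simp [pair, hs]) (fun i => by simp [pair, hr])
    (fun i => by rw [h₁, h₃]) (fun i => by rw [h₁', h₃'])
  have h42 := c.sameHom_of_flow 𝓕 α (δ := fun i => .const (a i)) (fun i z => ha i)
    (e := e₄) (e' := e₂) (c.coord_ext fun i => by simp [pair, hs])
    (c.coord_ext fun i => by simp [pair, hr]) rfl rfl h₄ h₄' h₂ h₂'
  -- This is `e₃ ≫ e₄` rotated so that the source becomes `1`.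
  obtain ⟨e₅, h₅, h₅'⟩ := c.exists_ext
    (p := c.basedPair fun i => Circle.angleDiff (c.coord q.src i) (c.coord (r p.tgt) i))
    (q := c.basedPair fun i => Circle.angleDiff (c.coord q.src i) (c.coord q.tgt i))
    0 (b + a) hz (fun i => add_nonneg (hb i) (ha i)) (fun i => by simp [basedPair, pair])
    (fun i => by
      simp only [basedPair, pair, coord_point, Circle.exp_angleDiff, hr, ht, Pi.add_apply,
        Circle.exp_add, Circle.exp_neg, div_eq_mul_inv]
      rw [mul_right_comm _ _ (c.coord q.src i)⁻¹, mul_right_comm _ (Circle.exp (a i))⁻¹,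
        mul_comm (Circle.exp (b i)), ← mul_assoc, inv_mul_cancel_right])
  refine ⟨_, _, e₅, fun i => ⟨Circle.angleDiff_nonneg _ _, Circle.angleDiff_lt_two_pi _ _⟩,
    fun i => ⟨Circle.angleDiff_nonneg _ _, Circle.angleDiff_lt_two_pi _ _⟩, h₅, ?_⟩
  have h345 := c.sameHom_of_rotation 𝓕 α (fun i => -Complex.arg (c.coord q.src i))
    (e := e₃ ≫ e₄) (e' := e₅)
    (fun i => by simp [basedPair, pair, Circle.exp_neg, Circle.exp_arg])
    (fun i => by simp [basedPair, pair, Circle.exp_neg, Circle.exp_arg, Circle.exp_angleDiff,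
      div_eq_mul_inv])
    (fun i => by simp [basedPair, pair, Circle.exp_neg, Circle.exp_arg])
    (fun i => by simp [basedPair, pair, Circle.exp_neg, Circle.exp_arg, Circle.exp_angleDiff,
      div_eq_mul_inv])
    (fun i => by rw [len_comp_fst, h₃, h₄, h₅]; simp)
    (fun i => by rw [len_comp_snd, h₃', h₄', h₅']; simp)
  refine SameHom.trans ?_ h345
  rw [he, Functor.map_comp, Functor.map_comp]
  exact h13.comp h42.symm

lemma arc_basedPair {u : Fin n → ℝ} (hu : ∀ i, 0 ≤ u i ∧ u i < 2 * Real.pi) (i : Fin n) :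
    c.arc (c.basedPair u) i = u i :=
  Circle.angleDiff_eq (hu i).1 (hu i).2 (by simp [basedPair, pair])

lemma bits_basedPair {u : Fin n → ℝ} (hu : ∀ i, 0 ≤ u i ∧ u i < 2 * Real.pi) (i : Fin n) :
    (c.bits (c.basedPair u)).bit i = true ↔ u i ≠ 0 := by
  rw [bits_eq_true_iff, not_iff_not]
  refine ⟨fun h => ?_, fun h => ?_⟩
  · rw [← c.arc_basedPair hu i, c.arc_eq_zero _ i h]
  · simp [basedPair, pair, h]

lemma degree_basedPair {u v : Fin n → ℝ} (hu : ∀ i, 0 ≤ u i ∧ u i < 2 * Real.pi)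
    (hv : ∀ i, 0 ≤ v i ∧ v i < 2 * Real.pi) {e : c.basedPair u ⟶ c.basedPair v} {i : Fin n}
    (h : c.len e.1 i = 0) : c.len e.2 i = c.degree e i * (2 * Real.pi) + v i - u i := by
  have := c.degree_spec e i
  rw [c.arc_basedPair hu, c.arc_basedPair hv, h] at this
  linarith

/-- The angular coordinates of the standard pair of a bit vector. -/
noncomputable def bitAngle (d : BitVec01 n) (i : Fin n) : ℝ := if d.bit i then Real.pi else 0

lemma bitAngle_mem (d : BitVec01 n) (i : Fin n) :
    0 ≤ bitAngle d i ∧ bitAngle d i < 2 * Real.pi := by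
  have := Real.pi_pos
  unfold bitAngle
  split_ifs <;> constructor <;> linarith

lemma exists_section_map {d d' : BitVec01 n} (k : d ⟶ d') :
    ∃ e : c.basedPair (bitAngle d) ⟶ c.basedPair (bitAngle d'), (∀ i, c.len e.1 i = 0) ∧
      ∀ i, c.len e.2 i = k.1 i * (2 * Real.pi) + bitAngle d' i - bitAngle d i := by
  refine c.exists_ext 0 _ (fun _ => le_rfl) (fun i => ?_) (fun i => by simp [basedPair, pair])
    fun i => ?_
  · have hk := k.2 i
    have hπ := Real.pi_pos
    have h0 : (0 : ℝ) ≤ k.1 i := Nat.cast_nonneg _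
    unfold bitAngle
    cases hd : d.bit i <;> cases hd' : d'.bit i <;> simp <;> try positivity
    -- For bits going from `1` to `0` the length is `2πk - π`; positivity of `k` is needed exactly
    -- here.
    have : (1 : ℝ) ≤ k.1 i := by exact_mod_cast hk hd hd'
    nlinarith
  · have := Circle.exp_int_mul_two_pi (k.1 i)
    rw [Int.cast_natCast] at this
    simp only [basedPair, pair, coord_point]
    rw [← Circle.exp_add, add_sub_cancel, Circle.exp_add, this, one_mul]

/-- The standard pairs, as a section of the degree functor. -/
noncomputable def sectionFunctor : BitVec01 n ⥤ RPair D where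
  obj d := c.basedPair (bitAngle d)
  map k := (c.exists_section_map k).choose
  map_id d := (c.sameHom_of_len rfl rfl
    (fun i => by rw [(c.exists_section_map _).choose_spec.1, len_id_fst])
    (fun i => by
      rw [(c.exists_section_map _).choose_spec.2, len_id_snd]
      change ((0 : ℕ) : ℝ) * _ + _ - _ = _
      simp)).eq
  map_comp k l := (c.sameHom_of_len rfl rfl
    (fun i => by
      rw [len_comp_fst]
      simp only [(c.exists_section_map _).choose_spec.1, add_zero])
    (fun i => by
      rw [len_comp_snd, (c.exists_section_map k).choose_spec.2,
        (c.exists_section_map l).choose_spec.2]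
      refine ((c.exists_section_map (k ≫ l)).choose_spec.2 i).trans ?_
      rw [BitVec01.comp_apply]
      push_cast
      ring)).eq

lemma len_section_fst {d d' : BitVec01 n} (k : d ⟶ d') (i : Fin n) :
    c.len (c.sectionFunctor.map k).1 i = 0 :=
  (c.exists_section_map k).choose_spec.1 i

lemma len_section_snd {d d' : BitVec01 n} (k : d ⟶ d') (i : Fin n) :
    c.len (c.sectionFunctor.map k).2 i =
      k.1 i * (2 * Real.pi) + bitAngle d' i - bitAngle d i :=
  (c.exists_section_map k).choose_spec.2 i

lemma sectionFunctor_comp_degreeFunctor : c.sectionFunctor ⋙ c.degreeFunctor = 𝟭 _ := by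
  have hobj : ∀ d, c.bits (c.basedPair (bitAngle d)) = d := fun d => BitVec01.ext_bit fun i => by
    rw [Bool.eq_iff_iff, c.bits_basedPair (bitAngle_mem d), bitAngle]
    cases d.bit i <;> simp [Real.pi_ne_zero]
  refine CategoryTheory.Functor.hext hobj fun d d' k => ?_
  refine (BitVec01.sameHom (hobj d) (hobj d') fun i => c.degree_eq _ i ?_).heq
  rw [len_section_fst, len_section_snd]
  change 0 + c.arc (c.basedPair (bitAngle d)) i + _ - c.arc (c.basedPair (bitAngle d')) i = _
  rw [c.arc_basedPair (bitAngle_mem d), c.arc_basedPair (bitAngle_mem d')]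
  change _ = (k.1 i : ℝ) * _
  ring

lemma exists_move {u v : Fin n → ℝ}
    (h : ∀ i, (u i = 0 ∧ v i = 0) ∨ (0 < u i ∧ u i ≤ v i ∧ v i < 2 * Real.pi)) :
    ∃ e : c.basedPair u ⟶ c.basedPair v, (∀ i, c.len e.1 i = 0) ∧
      (∀ i, c.len e.2 i = v i - u i) ∧
      SameHom ((pairComponent 𝓕 α D).map e) (𝟙 ((pairComponent 𝓕 α D).obj (c.basedPair u))) := by
  obtain ⟨e, h1, h2⟩ := c.exists_ext (p := c.basedPair u) (q := c.basedPair v) 0 (fun i => v i - u i)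
    (fun _ => le_rfl) (fun i => by
      rcases h i with ⟨h1, h2⟩ | ⟨-, h1, -⟩
      · simp [h1, h2]
      · exact sub_nonneg.2 h1) (fun i => by simp [basedPair, pair])
    (fun i => by simp [basedPair, pair])
  exact ⟨e, h1, h2, c.sameHom_id_of_move 𝓕 α h h1 h2⟩

/-- Targets in `(0, 2π)` can be moved to the standard angle `π` by extensions that become
identities. Up to such moves on both sides, `e` and the standard extension have the same lengths, so
they are equal. -/
lemma sameHom_section_of_based {u v : Fin n → ℝ} (hu : ∀ i, 0 ≤ u i ∧ u i < 2 * Real.pi)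
    (hv : ∀ i, 0 ≤ v i ∧ v i < 2 * Real.pi) {e : c.basedPair u ⟶ c.basedPair v}
    (h : ∀ i, c.len e.1 i = 0) : SameHom ((pairComponent 𝓕 α D).map e)
      ((pairComponent 𝓕 α D).map (c.sectionFunctor.map (c.degreeFunctor.map e))) := by
  have hπ := Real.pi_pos
  have hbit : ∀ {u : Fin n → ℝ} (_ : ∀ i, 0 ≤ u i ∧ u i < 2 * Real.pi) (i : Fin n),
      (u i = 0 ∧ bitAngle (c.bits (c.basedPair u)) i = 0) ∨
        (0 < u i ∧ bitAngle (c.bits (c.basedPair u)) i = Real.pi) := fun {u} hu i => by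
    have := c.bits_basedPair hu i
    unfold bitAngle
    rcases (hu i).1.eq_or_lt with h0 | h0
    · exact .inl ⟨h0.symm, if_neg (by rw [this]; exact fun h => h h0.symm)⟩
    · exact .inr ⟨h0, if_pos (this.2 h0.ne')⟩
  set x := bitAngle (c.bits (c.basedPair u))
  set y := bitAngle (c.bits (c.basedPair v))
  -- Trivial moves only go forward, so `u` and the standard angles are linked through their common
  -- predecessor, the minimum.
  obtain ⟨e₁, h₁, h₁', t₁⟩ := c.exists_move 𝓕 α (u := fun i => min (u i) (x i)) (v := u)
    fun i => by
      rcases hbit hu i with ⟨h, h'⟩ | ⟨h, h'⟩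
      · exact .inl ⟨by simp [x, h, h'], h⟩
      · exact .inr ⟨lt_min h (hπ.trans_eq h'.symm), min_le_left _ _, (hu i).2⟩
  obtain ⟨e₂, h₂, h₂', t₂⟩ := c.exists_move 𝓕 α (u := fun i => min (u i) (x i)) (v := x)
    fun i => by
      rcases hbit hu i with ⟨h, h'⟩ | ⟨h, h'⟩
      · exact .inl ⟨by simp [x, h, h'], h'⟩
      · exact .inr ⟨lt_min h (hπ.trans_eq h'.symm), min_le_right _ _, (bitAngle_mem _ i).2⟩
  -- At the codomain the link is the common successor, the maximum.
  obtain ⟨e₃, h₃, h₃', t₃⟩ := c.exists_move 𝓕 α (u := v) (v := fun i => max (v i) (y i))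
    fun i => by
      rcases hbit hv i with ⟨h, h'⟩ | ⟨h, h'⟩
      · exact .inl ⟨h, by simp [y, h, h']⟩
      · exact .inr ⟨h, le_max_left _ _, max_lt (hv i).2 (bitAngle_mem _ i).2⟩
  obtain ⟨e₄, h₄, h₄', t₄⟩ := c.exists_move 𝓕 α (u := y) (v := fun i => max (v i) (y i))
    fun i => by
      rcases hbit hv i with ⟨h, h'⟩ | ⟨h, h'⟩
      · exact .inl ⟨h', by simp [y, h, h']⟩
      · exact .inr ⟨hπ.trans_eq h'.symm, le_max_right _ _, max_lt (hv i).2 (bitAngle_mem _ i).2⟩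
  let s : c.basedPair x ⟶ c.basedPair y := c.sectionFunctor.map (c.degreeFunctor.map e)
  have hs : ∀ i, c.len s.1 i = 0 := c.len_section_fst _
  have hs' : ∀ i, c.len s.2 i = c.degree e i * (2 * Real.pi) + y i - x i := c.len_section_snd _
  have hcomm : e₁ ≫ e ≫ e₃ = e₂ ≫ s ≫ e₄ := by
    refine (c.sameHom_of_len rfl rfl (fun i => ?_) (fun i => ?_)).eq
    · simp only [len_comp_fst, h, h₁, h₂, h₃, h₄, hs]
    · simp only [len_comp_snd, h₁', h₂', h₃', h₄', hs', c.degree_basedPair hu hv (h i)]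
      ring
  have := congrArg (pairComponent 𝓕 α D).map hcomm
  simp only [Functor.map_comp] at this
  refine SameHom.trans ?_ ((SameHom.of_eq this).trans ?_)
  · exact ((SameHom.refl _).comp_id t₃).symm.trans ((SameHom.refl _).id_comp t₁.id_of_id).symm
  · exact ((SameHom.refl _).comp_id t₄).id_comp t₂.id_of_id

/-- The degree factors through the pair component category, so it cannot separate extensions that
agree there. -/
lemma sameHom_degree {p q p' q' : RPair D} {e : p ⟶ q} {e' : p' ⟶ q'}
    (h : SameHom ((pairComponent 𝓕 α D).map e) ((pairComponent 𝓕 α D).map e')) :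
    SameHom (c.degreeFunctor.map e) (c.degreeFunctor.map e') :=
  (SameHom.of_functor_eq (c.pairComponent_comp_componentDegree 𝓕 α) e).symm.trans
    ((h.map (c.componentDegree 𝓕 α)).trans
      (SameHom.of_functor_eq (c.pairComponent_comp_componentDegree 𝓕 α) e'))

/-- Every extension agrees with a standard one in the pair component category. -/
lemma sameHom_section {p q : RPair D} (e : p ⟶ q) : SameHom ((pairComponent 𝓕 α D).map e)
    ((pairComponent 𝓕 α D).map (c.sectionFunctor.map (c.degreeFunctor.map e))) := by
  obtain ⟨u, v, e', hu, hv, he', h⟩ := c.exists_based_sameHom 𝓕 α e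
  exact (h.trans (c.sameHom_section_of_based 𝓕 α hu hv he')).trans
    (((c.sameHom_degree 𝓕 α h).symm.map c.sectionFunctor).map (pairComponent 𝓕 α D))

lemma degreeFunctor_comp_section :
    c.degreeFunctor ⋙ c.sectionFunctor ⋙ pairComponent 𝓕 α D = pairComponent 𝓕 α D :=
  CategoryTheory.Functor.hext (fun p => (c.sameHom_section 𝓕 α (𝟙 p)).src_eq.symm)
    fun _ _ e => (c.sameHom_section 𝓕 α e).symm.heq

lemma componentDegree_comp_section :
    c.componentDegree 𝓕 α ⋙ c.sectionFunctor ⋙ pairComponent 𝓕 α D = 𝟭 _ := by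
  apply pairComponent_functor_ext
  rw [← Functor.assoc, pairComponent_comp_componentDegree, degreeFunctor_comp_section]
  rfl

lemma section_comp_componentDegree :
    (c.sectionFunctor ⋙ pairComponent 𝓕 α D) ⋙ c.componentDegree 𝓕 α = 𝟭 _ := by
  rw [Functor.assoc, pairComponent_comp_componentDegree, sectionFunctor_comp_degreeFunctor]

end TorusChart

end Section

/-! ## The pair component categories of directed tori -/

lemma TorusChart.isIso_componentDegree {X : Type u} [TopologicalSpace X] {D : DStructure X} {n : ℕ}
    (c : TorusChart D n) (𝓕 : EquivalenceFamily.{u}) (α : Flavour) :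
    IsIsoOfCategories (c.componentDegree 𝓕 α) :=
  ⟨c.sectionFunctor ⋙ pairComponent 𝓕 α D, c.componentDegree_comp_section 𝓕 α,
    c.section_comp_componentDegree 𝓕 α⟩

/-! ### Products of bit categories and isomorphisms of categories. -/

/-- The `i`-th coordinate of a bit vector. -/
def bitProj (n : ℕ) (i : Fin n) : BitVec01 n ⥤ BitVec01 1 where
  obj d := ⟨fun _ => d.bit i⟩
  map k := ⟨fun _ => k.1 i, fun _ => k.2 i⟩

/-- Bit vectors of length `n` form a product of categories. -/
def bitPi (n : ℕ) : (Fin n → BitVec01 1) ⥤ BitVec01 n where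
  obj d := ⟨fun i => (d i).bit 0⟩
  map k := ⟨fun i => (k i).1 0, fun i => (k i).2 0⟩

lemma bitProj_comp_bitPi (n : ℕ) : Functor.pi' (bitProj n) ⋙ bitPi n = 𝟭 _ := rfl

lemma bitPi_comp_bitProj (n : ℕ) (i : Fin n) :
    bitPi n ⋙ bitProj n i = Pi.eval (fun _ => BitVec01 1) i := by
  have h : ∀ d : Fin n → BitVec01 1, (bitPi n ⋙ bitProj n i).obj d = d i := fun d =>
    BitVec01.ext_bit fun j => by rw [Subsingleton.elim j 0]; rfl
  exact CategoryTheory.Functor.hext h fun d d' k => (BitVec01.sameHom (h d) (h d') fun j => by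
    rw [Subsingleton.elim j 0]; rfl).heq

lemma isIso_bit_pi (n : ℕ) {B : Type*} [Category* B] (G : BitVec01 1 ⥤ B) (P : B ⥤ BitVec01 1)
    (h1 : G ⋙ P = 𝟭 _) (h2 : P ⋙ G = 𝟭 _) :
    IsIsoOfCategories (Functor.pi' fun i => bitProj n i ⋙ G) := by
  refine ⟨Functor.pi' (fun i => Pi.eval (fun _ => B) i ⋙ P) ⋙ bitPi n, ?_, ?_⟩
  · have : Functor.pi' (fun i => bitProj n i ⋙ G) ⋙
        Functor.pi' (fun i => Pi.eval (fun _ => B) i ⋙ P) = Functor.pi' (bitProj n) := by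
      refine Functor.pi_ext _ _ fun i => ?_
      change bitProj n i ⋙ (G ⋙ P) = bitProj n i
      rw [h1, Functor.comp_id]
    rw [← Functor.assoc, this, bitProj_comp_bitPi]
  · refine Functor.pi_ext _ _ fun i => ?_
    change Functor.pi' (fun i => Pi.eval (fun _ => B) i ⋙ P) ⋙ (bitPi n ⋙ bitProj n i) ⋙ G = _
    rw [bitPi_comp_bitProj]
    change Pi.eval (fun _ => B) i ⋙ (P ⋙ G) = _
    rw [h2]
    rfl

lemma IsIsoOfCategories.comp {A : Type*} {B : Type*} {C : Type*} [Category* A] [Category* B]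
    [Category* C] {F : A ⥤ B} {G : B ⥤ C} (hF : IsIsoOfCategories F) (hG : IsIsoOfCategories G) :
    IsIsoOfCategories (F ⋙ G) := by
  obtain ⟨F', h1, h2⟩ := hF
  obtain ⟨G', h3, h4⟩ := hG
  refine ⟨G' ⋙ F', ?_, ?_⟩
  · change F ⋙ (G ⋙ G') ⋙ F' = _
    rw [h3]
    exact h1
  · change G' ⋙ (F' ⋙ F) ⋙ G = _
    rw [h2]
    exact h4

lemma IsIsoOfCategories.bijective_obj {A : Type*} {B : Type*} [Category* A] [Category* B]
    {F : A ⥤ B} (h : IsIsoOfCategories F) : Function.Bijective F.obj := by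
  obtain ⟨G, h1, h2⟩ := h
  exact Function.bijective_iff_has_inverse.2
    ⟨G.obj, fun a => Functor.congr_obj h1 a, fun b => Functor.congr_obj h2 b⟩

lemma natCard_bitVec (n : ℕ) : Nat.card (BitVec01 n) = 2 ^ n := by
  let e : BitVec01 n ≃ (Fin n → Bool) := ⟨BitVec01.bit, BitVec01.mk, fun _ => rfl, fun _ => rfl⟩
  rw [Nat.card_congr e]
  simp

/-- Length and arc are defined coordinate by coordinate, so the degree of a projected extension is a
coordinate of the degree. -/
lemma degreeFunctor_comp_bitProj (n : ℕ) (i : Fin n) :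
    (torusChart n).degreeFunctor ⋙ bitProj n i =
      extMap (torusProj n i) (isDMap_torusProj n i) ⋙ circleChart.degreeFunctor := by
  have h : ∀ p, ((torusChart n).degreeFunctor ⋙ bitProj n i).obj p =
      (extMap (torusProj n i) (isDMap_torusProj n i) ⋙ circleChart.degreeFunctor).obj p :=
    fun p => BitVec01.ext_bit fun j => by
      rw [Subsingleton.elim j 0]
      rfl
  refine CategoryTheory.Functor.hext h fun p q e => (BitVec01.sameHom (h p) (h q) fun j => ?_).heq
  rw [Subsingleton.elim j 0]
  refine (circleChart.degree_eq ((extMap (torusProj n i) (isDMap_torusProj n i)).map e) 0 ?_).symm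
  -- The projection has zero displacement with respect to the two charts.
  have hlen : ∀ {x y : Fin n → Circle} (σ : FundHom (dTorus n) x y),
      circleChart.len (FundHom.map _ (isDMap_torusProj n i) rfl rfl σ) 0 =
        (torusChart n).len σ i := fun {x y} σ => by
    rw [(torusChart n).len_map circleChart (torusProj n i) (isDMap_torusProj n i) rfl rfl i 0
      (fun _ => 0) continuous_const (fun x => by rw [Circle.exp_zero, mul_one]; rfl) σ]
    ring
  refine Eq.trans ?_ ((torusChart n).degree_spec e i)
  rw [← hlen e.1, ← hlen e.2]
  rfl

/-! ### Shifts as directed homeomorphisms of the circle, and the main theorem. -/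

namespace AngularShift

/-- The homeomorphism given by a shift. -/
noncomputable def toHomeomorph (δ : AngularShift) : Circle ≃ₜ Circle where
  toFun z := z * Circle.exp (δ z)
  invFun z := z * Circle.exp (δ.exists_inverse.choose z)
  left_inv z := by
    beta_reduce
    rw [δ.exists_inverse.choose_spec.1, mul_assoc, ← Circle.exp_add]
    simp
  right_inv z := by
    beta_reduce
    rw [δ.exists_inverse.choose_spec.2, mul_assoc, ← Circle.exp_add]
    simp
  continuous_toFun := by fun_prop
  continuous_invFun := by fun_prop

lemma isDMap_mul_exp (δ : AngularShift) (f : C(Circle, Circle))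
    (hf : ∀ z, f z = z * Circle.exp (δ z)) : IsDMap dCircle dCircle f := by
  convert circleChart.isDMap_shiftMap fun _ => δ
  ext z
  rw [hf]
  rfl

end AngularShift

theorem mainTheorem2 (n : ℕ) (𝓕 : EquivalenceFamily.{0}) (α : Flavour) :
    (∃ Φ : PairComponentCategory 𝓕 α (dTorus n) ⥤ (Fin n → PairComponentCategory 𝓕 α dCircle),
      IsIsoOfCategories Φ ∧
      pairComponent 𝓕 α (dTorus n) ⋙ Φ =
        Functor.pi' fun i =>
          extMap (torusProj n i) (isDMap_torusProj n i) ⋙ pairComponent 𝓕 α dCircle) ∧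
    (∃ Ψ : PairComponentCategory 𝓕 α (dTorus n) ⥤ BitVec01 n,
      IsIsoOfCategories Ψ ∧
      ∀ (p : RPair (dTorus n)) (i : Fin n),
        (Ψ.obj ((pairComponent 𝓕 α (dTorus n)).obj p)).bit i = true ↔ p.src i ≠ p.tgt i) ∧
    Nat.card (PairComponentCategory 𝓕 α (dTorus n)) = 2 ^ n ∧
    (∀ (f : C(Fin n → Circle, Fin n → Circle)) (p q : RPair (dTorus n)),
      IsInessential 𝓕 (dTorus n) α f p q →
      ∃ g : Fin n → (Circle ≃ₜ Circle),
        (∀ i, IsDMap dCircle dCircle (g i : C(Circle, Circle)) ∧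
          IsDMap dCircle dCircle ((g i).symm : C(Circle, Circle))) ∧
        ∀ x i, f x i = g i (x i)) := by
  have hiso := (torusChart n).isIso_componentDegree 𝓕 α
  -- The isomorphism to the product passes through bit vectors: the degree isomorphism of the torus,
  -- followed in each coordinate by the inverse of the one of the circle.
  refine ⟨⟨(torusChart n).componentDegree 𝓕 α ⋙ Functor.pi' fun i =>
      bitProj n i ⋙ circleChart.sectionFunctor ⋙ pairComponent 𝓕 α dCircle,
      hiso.comp (isIso_bit_pi n _ _ (circleChart.section_comp_componentDegree 𝓕 α)
        (circleChart.componentDegree_comp_section 𝓕 α)), ?_⟩,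
    ⟨(torusChart n).componentDegree 𝓕 α, hiso, fun p i => (torusChart n).bits_eq_true_iff p i⟩,
    ?_, fun f p q hf => ?_⟩
  · rw [← Functor.assoc, TorusChart.pairComponent_comp_componentDegree]
    refine Functor.pi_ext _ _ fun i => ?_
    rw [Functor.pi'_eval]
    change ((torusChart n).degreeFunctor ⋙ bitProj n i) ⋙ circleChart.sectionFunctor ⋙
      pairComponent 𝓕 α dCircle = _
    rw [degreeFunctor_comp_bitProj, Functor.assoc, TorusChart.degreeFunctor_comp_section]
  · rw [Nat.card_congr (Equiv.ofBijective _ hiso.bijective_obj), natCard_bitVec]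
  · obtain ⟨δ, rfl⟩ := (torusChart n).exists_shift_of_isInessential 𝓕 hf
    exact ⟨fun i => (δ i).toHomeomorph, fun i => ⟨(δ i).isDMap_mul_exp _ fun z => rfl,
      ((δ i).exists_inverse.choose).isDMap_mul_exp _ fun z => rfl⟩, fun x i => rfl⟩
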